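/- Variables range over a countably infinite set. A theory is the class of all interpretations (with nonempty domain and with values for all variables) of a set of first-order sentences with equality, its axioms; a formula is $T$-satisfiable if some interpretation in $T$ satisfies it. A theory $T$ is *decidable* if the set of $T$-satisfiable quantifier-free formulas is decidable. $T$ has the *finite model property* if every quantifier-free formula satisfied by some interpretation in $T$ is satisfied by a finite one in $T$. A *minimal model function* of $T$ is a function $m$ from the quantifier-free formulas to $\mathbb N\cup\{\aleph_0\}$ such that, for every $T$-satisfiable quantifier-free $\varphi$, some interpretation in $T$ satisfying $\varphi$ has a domain of cardinality $m(\varphi)$, and every interpretation in $T$ satisfying $\varphi$ has a domain of cardinality at least $m(\varphi)$. $T$ is *smooth* if, whenever $\varphi$ is quantifier-free, $\mathcal A$ is an interpretation in $T$ satisfying $\varphi$, and $\kappa>|\mathcal A|$ is a cardinal, some interpretation in $T$ with a domain of cardinality $\kappa$ satisfies $\varphi$. For theories $T_1,T_2$ over disjoint signatures, $T_1\oplus T_2$ is the theory over the union of the signatures whose axioms are those of $T_1$ together with those of $T_2$. Call $f:\{1,2,\dots\}\to\{0,1\}$ *admissible* if $f$ is not computable, $f(1)=1$, and, for every $k\ge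 1$, $f$ takes the values $0$ and $1$ equally often on $\{1,\dots,2^k\}$. Let $f_i(k)$ be the number of $j\in\{1,\dots,k\}$ with $f(j)=i$. Let $\Sigma_s$ be the signature with a single unary function symbol $s$ and no predicate symbol except equality, and let $T_f$ be the $\Sigma_s$-theory with, for each $k\ge1$, the axiom $$\bigl[\psi^{=}_{\ge f_1(k)}\wedge\psi^{\ne}_{\ge f_0(k)}\bigr]\vee\bigvee_{i=1}^{k}\bigl[\psi^{=}_{=f_1(i)}\wedge\psi^{\ne}_{=f_0(i)}\bigr],$$ where $\psi^{=}_{\ge n}$ and $\psi^{=}_{=n}$ (respectively $\psi^{\ne}_{\ge n}$ and $\psi^{\ne}_{=n}$) are the first-order sentences saying that at least $n$, respectively exactly $n$, elements $x$ satisfy $s(x)=x$ (respectively $s(x)\neq x$). Let $\Sigma_P$ be the signature with nullary predicate symbols $P_1,P_2,\dots$ and no function symbol, and let $T_=$ be the $\Sigma_P$-theory with the axioms $P_n\to\psi_{=n}$ for $n\ge1$, where $\psi_{=n}$ is the first-order sentence saying that the domain has exactly $n$ elements. **Theorem.** Admissible functions exist. For every admissible $f$, the theories $T_1=T_f$ and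 $T_2=T_=$, whose signatures are disjoint, are both decidable; $T_2$ has the finite model property and a computable minimal model function, but is not smooth; and $T_1\oplus T_2$ is undecidable. In particular, there are decidable theories $T_1,T_2$ over disjoint signatures such that $T_2$ has the finite model property and a computable minimal model function, but $T_1\oplus T_2$ is undecidable. -/

import Mathlib

namespace TheoryCombination

open FirstOrder FirstOrder.Language

/-! ### Interpretations, theories, satisfiability

Signatures are first-order languages; equality is a logical symbol of every language.  The
variables are indexed by `ℕ`, so a formula is an `L.Formula ℕ` and a quantifier-free formula is one
that satisfies `IsQF`.  A theory is given by its axiomatization, a set of sentences. -/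

/-- An `L`-interpretation: a domain, the meaning of the symbols of `L` on it, and a value in the
domain for each variable (so that the domain is nonempty). -/
structure Interpretation (L : FirstOrder.Language.{0, 0}) where
  /-- the domain -/
  dom : Type
  /-- the interpretation of the function and predicate symbols -/
  str : L.Structure dom
  /-- the values of the variables -/
  val : ℕ → dom

/-- `A` satisfies the formula `φ`. -/
def Interpretation.Satisfies {L : FirstOrder.Language.{0, 0}} (A : Interpretation L) (φ : L.Formula ℕ) :
    Prop :=
  letI := A.str
  φ.Realize A.val

/-- `A` is a `T`-interpretation: it satisfies all axioms of `T`. -/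
def Interpretation.IsModelOf {L : FirstOrder.Language.{0, 0}} (A : Interpretation L) (T : L.Theory) : Prop :=
  letI := A.str
  A.dom ⊨ T

/-- `φ` is `T`-satisfiable. -/
def Satisfiable {L : FirstOrder.Language.{0, 0}} (T : L.Theory) (φ : L.Formula ℕ) : Prop :=
  ∃ A : Interpretation L, A.IsModelOf T ∧ A.Satisfies φ

/-- The combination `T₁ ⊕ T₂`: the theory over the disjoint union of the two signatures that is
axiomatized by the union of the axioms of `T₁` and `T₂`. -/
def combine {L₁ L₂ : FirstOrder.Language.{0, 0}} (T₁ : L₁.Theory) (T₂ : L₂.Theory) : (L₁.sum L₂).Theory :=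
  (LHom.sumInl : L₁ →ᴸ L₁.sum L₂).onTheory T₁ ∪ (LHom.sumInr : L₂ →ᴸ L₁.sum L₂).onTheory T₂

/-! ### Gödel numbering of formulas -/

section Coding

variable {L : FirstOrder.Language.{0, 0}} [∀ n, Encodable (L.Functions n)] [∀ n, Encodable (L.Relations n)]

/-- The Gödel number of a term. -/
def termCode {α : Type} [Encodable α] : L.Term α → ℕ
  | .var a => 2 * Encodable.encode a
  | @Term.func _ _ n f ts =>
      2 * Nat.pair (Nat.pair n (Encodable.encode f))
        (Encodable.encode (List.ofFn fun i => termCode (ts i))) + 1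

/-- The Gödel number of a formula. -/
def formulaCode : ∀ {k : ℕ}, L.BoundedFormula ℕ k → ℕ
  | _, .falsum => 0
  | _, .equal t u => 4 * Nat.pair (termCode t) (termCode u) + 1
  | _, @BoundedFormula.rel _ _ _ n R ts =>
      4 * Nat.pair (Nat.pair n (Encodable.encode R))
        (Encodable.encode (List.ofFn fun i => termCode (ts i))) + 2
  | _, .imp φ ψ => 4 * Nat.pair (formulaCode φ) (formulaCode ψ) + 3
  | _, .all φ => 4 * formulaCode φ + 4

/-- `T` is decidable: the set of (Gödel numbers of) `T`-satisfiable quantifier-free formulas is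
computable. -/
def IsDecidable (T : L.Theory) : Prop :=
  ComputablePred fun c : ℕ => ∃ φ : L.Formula ℕ, φ.IsQF ∧ Satisfiable T φ ∧ formulaCode φ = c

end Coding

instance sumFunctionsEncodable {L₁ L₂ : FirstOrder.Language.{0, 0}} [∀ n, Encodable (L₁.Functions n)]
    [∀ n, Encodable (L₂.Functions n)] (n : ℕ) : Encodable ((L₁.sum L₂).Functions n) :=
  inferInstanceAs (Encodable (L₁.Functions n ⊕ L₂.Functions n))

instance sumRelationsEncodable {L₁ L₂ : FirstOrder.Language.{0, 0}} [∀ n, Encodable (L₁.Relations n)]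
    [∀ n, Encodable (L₂.Relations n)] (n : ℕ) : Encodable ((L₁.sum L₂).Relations n) :=
  inferInstanceAs (Encodable (L₁.Relations n ⊕ L₂.Relations n))

/-! ### The properties of theories involved in shiny combination -/

/-- `T` has the finite model property. -/
def HasFiniteModelProperty {L : FirstOrder.Language.{0, 0}} (T : L.Theory) : Prop :=
  ∀ φ : L.Formula ℕ, φ.IsQF → ∀ A : Interpretation L, A.IsModelOf T → A.Satisfies φ →
    ∃ B : Interpretation L, B.IsModelOf T ∧ B.Satisfies φ ∧ Cardinal.mk B.dom < Cardinal.aleph0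

/-- `T` is smooth. -/
def IsSmooth {L : FirstOrder.Language.{0, 0}} (T : L.Theory) : Prop :=
  ∀ φ : L.Formula ℕ, φ.IsQF → ∀ A : Interpretation L, A.IsModelOf T → A.Satisfies φ →
    ∀ κ : Cardinal.{0}, Cardinal.mk A.dom < κ →
      ∃ B : Interpretation L, B.IsModelOf T ∧ B.Satisfies φ ∧ Cardinal.mk B.dom = κ

/-- `m` is a minimal model function of `T`; its values are in `ℕ ∪ {ℵ₀}`, that is, in `ℕ∞`. -/
def IsMinimalModelFunction {L : FirstOrder.Language.{0, 0}} (T : L.Theory)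
    (m : {φ : L.Formula ℕ // φ.IsQF} → ℕ∞) : Prop :=
  ∀ φ : {φ : L.Formula ℕ // φ.IsQF}, Satisfiable T φ.1 →
    (∃ A : Interpretation L, A.IsModelOf T ∧ A.Satisfies φ.1 ∧
      Cardinal.mk A.dom = (m φ : Cardinal.{0})) ∧
    ∀ B : Interpretation L, B.IsModelOf T → B.Satisfies φ.1 →
      (m φ : Cardinal.{0}) ≤ Cardinal.mk B.dom

/-- Elements of `ℕ∞ = ℕ ∪ {∞}` are handled by algorithms as elements of `Option ℕ`. -/
instance enatPrimcodable : Primcodable ℕ∞ :=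
  inferInstanceAs (Primcodable (Option ℕ))

/-- `T` has a minimal model function that is computable (on Gödel numbers). -/
def HasComputableMinimalModelFunction {L : FirstOrder.Language.{0, 0}} [∀ n, Encodable (L.Functions n)]
    [∀ n, Encodable (L.Relations n)] (T : L.Theory) : Prop :=
  ∃ m : {φ : L.Formula ℕ // φ.IsQF} → ℕ∞, IsMinimalModelFunction T m ∧
    ∃ g : ℕ → ℕ∞, Computable g ∧ ∀ φ, g (formulaCode φ.1) = m φ

/-! ### Cardinality formulas -/

section CardinalityFormulas

variable {L : FirstOrder.Language.{0, 0}}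

/-- `x₁, …, xₙ` are pairwise distinct. -/
noncomputable def distinct (n : ℕ) : L.BoundedFormula Empty n :=
  BoundedFormula.iInf fun ij : {ij : Fin n × Fin n // ij.1 < ij.2} => ∼(&ij.1.1 =' &ij.1.2)

/-- `∃ x₁ … xₙ, ≠(x₁, …, xₙ) ∧ p(x₁) ∧ … ∧ p(xₙ)`, where `p` is a formula with a term as
argument: at least `n` elements satisfy `p`. -/
noncomputable def countGe (p : ∀ {k : ℕ}, L.Term (Empty ⊕ Fin k) → L.BoundedFormula Empty k)
    (n : ℕ) : L.Sentence :=
  (distinct n ⊓ BoundedFormula.iInf fun i : Fin n => p (&i)).exs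

/-- `∃ x₁ … xₙ, ≠(x₁, …, xₙ) ∧ p(x₁) ∧ … ∧ p(xₙ) ∧ ∀ x, p(x) → x = x₁ ∨ … ∨ x = xₙ`:
exactly `n` elements satisfy `p`. -/
noncomputable def countEq (p : ∀ {k : ℕ}, L.Term (Empty ⊕ Fin k) → L.BoundedFormula Empty k)
    (n : ℕ) : L.Sentence :=
  (distinct n ⊓ (BoundedFormula.iInf fun i : Fin n => p (&i)) ⊓
    ∀' (p (&(Fin.last n)) ⟹
      BoundedFormula.iSup fun i : Fin n => &(Fin.last n) =' &i.castSucc)).exs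

/-- `∃ x₁ … xₙ, ≠(x₁, …, xₙ)`: the domain has at least `n` elements. -/
noncomputable def cardAtLeast (n : ℕ) : L.Sentence :=
  (distinct n).exs

/-- `∃ x₁ … xₙ, ∀ y, y = x₁ ∨ … ∨ y = xₙ`: the domain has at most `n` elements. -/
noncomputable def cardAtMost (n : ℕ) : L.Sentence :=
  (∀' (BoundedFormula.iSup fun i : Fin n => &(Fin.last n) =' &i.castSucc)).exs

/-- The domain has exactly `n` elements. -/
noncomputable def cardExactly (n : ℕ) : L.Sentence :=
  cardAtLeast n ⊓ cardAtMost n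

end CardinalityFormulas

/-! ### The theory `T_f` -/

/-- The function symbols of `Σ_s`: a single unary symbol `s`. -/
def SFunctions : ℕ → Type
  | 1 => Unit
  | _ => Empty

/-- The signature `Σ_s`, with a unary function symbol `s` and no predicate symbol but equality. -/
def sigmaS : FirstOrder.Language.{0, 0} := ⟨SFunctions, fun _ => Empty⟩

instance sFunctionsEncodable : ∀ n, Encodable (sigmaS.Functions n)
  | 0 => inferInstanceAs (Encodable Empty)
  | 1 => inferInstanceAs (Encodable Unit)
  | _ + 2 => inferInstanceAs (Encodable Empty)

instance sRelationsEncodable (n : ℕ) : Encodable (sigmaS.Relations n) :=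
  inferInstanceAs (Encodable Empty)

/-- The symbol `s`. -/
def sSymbol : sigmaS.Functions 1 := ()

/-- `s(t) = t`. -/
def fixedBy {k : ℕ} (t : sigmaS.Term (Empty ⊕ Fin k)) : sigmaS.BoundedFormula Empty k :=
  Term.func sSymbol ![t] =' t

/-- `¬ s(t) = t`. -/
def movedBy {k : ℕ} (t : sigmaS.Term (Empty ⊕ Fin k)) : sigmaS.BoundedFormula Empty k :=
  ∼(fixedBy t)

/-- The number of `i ∈ {1, …, k}` that `f` maps to `b`: `f₁(k)` for `b = true`, `f₀(k)` for
`b = false`. -/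
def countValues (f : ℕ+ → Bool) (b : Bool) (k : ℕ+) : ℕ :=
  ((Finset.Icc 1 k).filter fun i => f i = b).card

/-- The functions `f` from the positive integers to `{0, 1}` used to define `T_f`: `f` is not
computable, `f(1) = 1`, and, for `k ≥ 1`, `f` maps half of the numbers in `{1, …, 2 ^ k}` to `1`
and the other half to `0`. -/
def IsAdmissible (f : ℕ+ → Bool) : Prop :=
  ¬ Computable f ∧ f 1 = true ∧
    ∀ k : ℕ, 1 ≤ k → countValues f true (2 ^ k) = countValues f false (2 ^ k)

/-- The axiom of `T_f` with index `k`. -/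
noncomputable def axiomTf (f : ℕ+ → Bool) (k : ℕ+) : sigmaS.Sentence :=
  (countGe fixedBy (countValues f true k) ⊓ countGe movedBy (countValues f false k)) ⊔
    BoundedFormula.iSup fun i : {i : ℕ+ // i ≤ k} =>
      countEq fixedBy (countValues f true i) ⊓ countEq movedBy (countValues f false i)

/-- The theory `T_f`. -/
noncomputable def Tf (f : ℕ+ → Bool) : sigmaS.Theory :=
  Set.range (axiomTf f)

/-! ### The theory `T_=` -/

/-- The predicate symbols of `Σ_P`: symbols `P₁, P₂, …` of arity `0`. -/
def PRelations : ℕ → Type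
  | 0 => ℕ+
  | _ => Empty

/-- The signature `Σ_P`, with `0`-ary predicate symbols `P₁, P₂, …` and no function symbol. -/
def sigmaP : FirstOrder.Language.{0, 0} := ⟨fun _ => Empty, PRelations⟩

instance pFunctionsEncodable (n : ℕ) : Encodable (sigmaP.Functions n) :=
  inferInstanceAs (Encodable Empty)

instance pRelationsEncodable : ∀ n, Encodable (sigmaP.Relations n)
  | 0 => inferInstanceAs (Encodable ℕ+)
  | _ + 1 => inferInstanceAs (Encodable Empty)

/-- The symbol `Pₙ`. -/
def pSymbol (n : ℕ+) : sigmaP.Relations 0 := n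

/-- The theory `T_=`, with the axioms `Pₙ → (the domain has exactly n elements)`, `n ≥ 1`. -/
noncomputable def Teq : sigmaP.Theory :=
  Set.range fun n : ℕ+ => (BoundedFormula.rel (pSymbol n) ![] ⟹ cardExactly n : sigmaP.Sentence)

end TheoryCombination

/-! The finite models of `Tf f` encode `f`. Since f₁(k) + f₀(k) = k, the axiom with index n leaves a
model of size n only one way to split into fixed and moved points: exactly f₁(n) are fixed
(`encard_fixedSet_of_model`). Quantifier-free Σ_s-formulas alone cannot exploit this, because they
cannot force a domain to be finite. In the combination P_n fixes the size, so P_n together with k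
distinct fixed points is satisfiable iff k ≤ f₁(n) (`satisfiable_sizeAndFixedPoints_iff`). A
decision procedure would thus compute f₁ step by step, and with it `f`
(`computable_of_isDecidable_combine`).

`Tf f` is decidable because `f` does not affect quantifier-free satisfiability: a satisfying
interpretation can be cut down to the finitely many relevant term values (`satS_of_realize`), and
adding infinitely many fixed and infinitely many moved points yields a model of `Tf f`
(`satisfiable_Tf_of_satS`).

For `Teq`, a formula with code c involves only P_n with n ≤ c + 1 and variables of index at most c.
Either one of these P_n holds and the domain has n elements, or the domain can be shrunk to the
values of these variables (`exists_satSize_of_model`). Sizes up to c + 1 therefore suffice, which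
gives decidability, the finite model property and computable minimal sizes. Finite interpretations
are coded by the digits of numbers, so all these searches are bounded and primitive recursive in c.
-/

namespace TheoryCombination

open FirstOrder FirstOrder.Language

/-! ### Course-of-values recursion -/

section StrongRecursion

variable {α σ : Type}

/-- The list of the first `n` values of the function defined by course-of-values recursion
with step `g`. -/
def strongRecHistory (g : List σ → σ) : ℕ → List σ
  | 0 => []
  | n + 1 => strongRecHistory g n ++ [g (strongRecHistory g n)]

/-- The function defined by course-of-values recursion with step `g`. -/
def strongRecValue (g : List σ → σ) (n : ℕ) : σ :=
  g (strongRecHistory g n)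

theorem strongRecHistory_eq (g : List σ → σ) (n : ℕ) :
    strongRecHistory g n = (List.range n).map (strongRecValue g) := by
  induction n with
  | zero => rfl
  | succ n ih =>
    rw [List.range_succ, List.map_append, ← ih]
    rfl

theorem strongRecValue_eq (g : List σ → σ) (n : ℕ) :
    strongRecValue g n = g ((List.range n).map (strongRecValue g)) := by
  rw [← strongRecHistory_eq]
  rfl

theorem getD_map_range (f : ℕ → σ) {n k : ℕ} (d : σ) (h : k < n) :
    ((List.range n).map f).getD k d = f k := by
  simp [List.getD, h]

theorem primrec_strongRecValue [Primcodable α] [Primcodable σ] {g : α → List σ → σ}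
    (hg : Primrec₂ g) : Primrec₂ fun a n => strongRecValue (g a) n := by
  exact Primrec.nat_strong_rec _ (g := fun a l => some (g a l)) (Primrec.option_some.comp hg)
    fun a n => congrArg some (strongRecValue_eq (g a) n).symm

end StrongRecursion

/-! ### Recursion on codes of formulas -/

section FormulaFold

variable {α : Type}

/-- The step of the recursion on codes of formulas. -/
def formulaStep (z : Bool) (e : α → ℕ → ℕ → Bool) (r : α → ℕ → Bool) (i : Bool → Bool → Bool)
    (a : α) (l : List Bool) : Bool :=
  -- The history has one entry for each smaller code, so `l.length` is the code being evaluated.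
  if l.length = 0 then z
  else if l.length % 4 = 1 then e a (l.length / 4).unpair.1 (l.length / 4).unpair.2
  else if l.length % 4 = 2 then r a (l.length / 4)
  else if l.length % 4 = 3 then
    i (l.getD (l.length / 4).unpair.1 false) (l.getD (l.length / 4).unpair.2 false)
  else false

/-- Recursion on codes of formulas; `z`, `e`, `r`, `i` say what to do with `⊥`, equations, atoms
and implications, and universal formulas get the value `false`. -/
def formulaFold (z : Bool) (e : α → ℕ → ℕ → Bool) (r : α → ℕ → Bool) (i : Bool → Bool → Bool)
    (a : α) (c : ℕ) : Bool :=
  strongRecValue (formulaStep z e r i a) c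

theorem primrecRel_exists_lt {β : Type} [Primcodable β] {R : ℕ → β → Prop} (hR : PrimrecRel R) :
    PrimrecRel fun (n : ℕ) (y : β) => ∃ x < n, R x y :=
  (hR.exists_mem_list.comp (Primrec.list_range.comp Primrec.fst) Primrec.snd).of_eq (by simp)

theorem primrec_natPow : Primrec₂ fun m n : ℕ => m ^ n :=
  Primrec₂.unpaired'.1 Nat.Primrec.pow

theorem primrec_formulaFold [Primcodable α] (z : Bool) {e : α → ℕ → ℕ → Bool}
    {r : α → ℕ → Bool} {i : Bool → Bool → Bool}
    (he : Primrec fun p : α × ℕ × ℕ => e p.1 p.2.1 p.2.2) (hr : Primrec₂ r) :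
    Primrec₂ (formulaFold z e r i) := by
  apply primrec_strongRecValue
  have hl : Primrec fun p : α × List Bool => p.2.length := Primrec.list_length.comp Primrec.snd
  have hm : Primrec fun p : α × List Bool => p.2.length % 4 :=
    Primrec.nat_mod.comp hl (Primrec.const 4)
  have hd : Primrec fun p : α × List Bool => p.2.length / 4 :=
    Primrec.nat_div.comp hl (Primrec.const 4)
  have hu := Primrec.unpair.comp hd
  have h1 := Primrec.fst.comp hu
  have h2 := Primrec.snd.comp hu
  refine Primrec.ite (Primrec.eq.comp hl (Primrec.const 0)) (Primrec.const z) ?_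
  refine Primrec.ite (Primrec.eq.comp hm (Primrec.const 1))
    (he.comp (Primrec.fst.pair (h1.pair h2))) ?_
  refine Primrec.ite (Primrec.eq.comp hm (Primrec.const 2)) (hr.comp Primrec.fst hd) ?_
  refine Primrec.ite (Primrec.eq.comp hm (Primrec.const 3)) ?_ (Primrec.const false)
  exact (Primrec.dom_bool₂ i).comp ((Primrec.list_getD false).comp Primrec.snd h1)
    ((Primrec.list_getD false).comp Primrec.snd h2)

variable (z : Bool) (e : α → ℕ → ℕ → Bool) (r : α → ℕ → Bool) (i : Bool → Bool → Bool) (a : α)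

theorem formulaFold_zero : formulaFold z e r i a 0 = z := rfl

theorem formulaFold_equal (t u : ℕ) :
    formulaFold z e r i a (4 * Nat.pair t u + 1) = e a t u := by
  have h1 : (4 * Nat.pair t u + 1) % 4 = 1 := by omega
  have h2 : (4 * Nat.pair t u + 1) / 4 = Nat.pair t u := by omega
  rw [formulaFold, strongRecValue_eq]
  simp [formulaStep, h1, h2]

theorem formulaFold_rel (x : ℕ) : formulaFold z e r i a (4 * x + 2) = r a x := by
  have h1 : (4 * x + 2) % 4 = 2 := by omega
  have h2 : (4 * x + 2) / 4 = x := by omega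
  rw [formulaFold, strongRecValue_eq]
  simp [formulaStep, h1, h2]

theorem formulaFold_imp (x y : ℕ) :
    formulaFold z e r i a (4 * Nat.pair x y + 3) =
      i (formulaFold z e r i a x) (formulaFold z e r i a y) := by
  have h1 : (4 * Nat.pair x y + 3) % 4 = 3 := by omega
  have h2 : (4 * Nat.pair x y + 3) / 4 = Nat.pair x y := by omega
  have hx : x < 4 * Nat.pair x y + 3 := by have := Nat.left_le_pair x y; omega
  have hy : y < 4 * Nat.pair x y + 3 := by have := Nat.right_le_pair x y; omega
  rw [formulaFold, strongRecValue_eq, formulaStep]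
  simp only [List.length_map, List.length_range, h1, h2, Nat.unpair_pair, getD_map_range _ _ hx,
    getD_map_range _ _ hy]
  simp [formulaFold]

theorem formulaFold_all (x : ℕ) : formulaFold z e r i a (4 * x + 4) = false := by
  have h1 : (4 * x + 4) % 4 = 0 := by omega
  rw [formulaFold, strongRecValue_eq]
  simp [formulaStep, h1]

end FormulaFold

/-! ### Recognizing codes of quantifier-free formulas -/

section Recognition

variable {L : FirstOrder.Language.{0, 0}} [∀ n, Encodable (L.Functions n)]
  [∀ n, Encodable (L.Relations n)]

/-- The codes of quantifier-free formulas, given tests for the codes of terms and atoms. -/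
def isQFCode (tm : ℕ → Bool) (rl : ℕ → Bool) (c : ℕ) : Bool :=
  formulaFold true (fun _ t u => tm t && tm u) (fun _ x => rl x) (fun x y => x && y) () c

theorem primrec_isQFCode {tm rl : ℕ → Bool} (htm : Primrec tm) (hrl : Primrec rl) :
    Primrec (isQFCode tm rl) := by
  refine (primrec_formulaFold true (α := Unit) ?_ ?_).comp (Primrec.const ()) Primrec.id
  · exact Primrec.and.comp (htm.comp (Primrec.fst.comp Primrec.snd))
      (htm.comp (Primrec.snd.comp Primrec.snd))
  · exact hrl.comp Primrec.snd

/-- `rl` tests for the codes of atomic formulas that are not equations, without the tag. -/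
def IsRelTest (L : FirstOrder.Language.{0, 0}) [∀ n, Encodable (L.Functions n)]
    [∀ n, Encodable (L.Relations n)] (rl : ℕ → Bool) : Prop :=
  ∀ x, rl x = true ↔ ∃ (n : ℕ) (R : L.Relations n) (ts : Fin n → L.Term (ℕ ⊕ Fin 0)),
    Nat.pair (Nat.pair n (Encodable.encode R))
      (Encodable.encode (List.ofFn fun i => termCode (ts i))) = x

/-- The residue modulo 4 reveals the outermost constructor, and components have smaller codes, so a
formula can be rebuilt by strong induction. Positive multiples of 4 are universal formulas and are
rejected. -/
theorem isQFCode_iff {tm rl : ℕ → Bool}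
    (htm : ∀ x, tm x = true ↔ ∃ t : L.Term (ℕ ⊕ Fin 0), termCode t = x)
    (hrl : IsRelTest L rl) (c : ℕ) :
    isQFCode tm rl c = true ↔ ∃ φ : L.Formula ℕ, φ.IsQF ∧ formulaCode φ = c := by
  constructor
  · induction c using Nat.strong_induction_on with
    | _ c ih =>
    intro h
    rcases Nat.eq_zero_or_pos c with rfl | hc
    · exact ⟨⊥, BoundedFormula.IsQF.falsum, rfl⟩
    obtain ⟨q, hq | hq | hq | hq⟩ : ∃ q, c = 4 * q + 1 ∨ c = 4 * q + 2 ∨ c = 4 * q + 3 ∨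
        c = 4 * q + 4 := ⟨(c - 1) / 4, by omega⟩
    · rw [← Nat.pair_unpair q] at hq
      rw [hq, isQFCode, formulaFold_equal, Bool.and_eq_true, htm, htm] at h
      obtain ⟨⟨t, ht⟩, u, hu⟩ := h
      exact ⟨.equal t u, .of_isAtomic (.equal t u), by rw [formulaCode, ht, hu, hq]⟩
    · rw [hq, isQFCode, formulaFold_rel, hrl] at h
      obtain ⟨n, R, ts, h⟩ := h
      exact ⟨.rel R ts, .of_isAtomic (.rel R ts), by rw [formulaCode, h, hq]⟩
    · have h1 : q.unpair.1 < c := by have := Nat.unpair_left_le q; omega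
      have h2 : q.unpair.2 < c := by have := Nat.unpair_right_le q; omega
      rw [← Nat.pair_unpair q] at hq
      rw [hq, isQFCode, formulaFold_imp, Bool.and_eq_true] at h
      obtain ⟨φ, hφ, hφc⟩ := ih _ h1 h.1
      obtain ⟨ψ, hψ, hψc⟩ := ih _ h2 h.2
      refine ⟨BoundedFormula.imp φ ψ, hφ.imp hψ, ?_⟩
      rw [formulaCode, hq]
      exact congrArg₂ (fun x y => 4 * Nat.pair x y + 3) hφc hψc
    · rw [hq, isQFCode, formulaFold_all] at h
      exact absurd h (by decide)
  · rintro ⟨φ, hφ, rfl⟩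
    induction hφ with
    | falsum => rfl
    | of_isAtomic h =>
      cases h with
      | equal t u =>
        rw [Term.bdEqual, formulaCode, isQFCode, formulaFold_equal, Bool.and_eq_true, htm, htm]
        exact ⟨⟨t, rfl⟩, u, rfl⟩
      | rel R ts =>
        rw [Relations.boundedFormula, formulaCode, isQFCode, formulaFold_rel, hrl]
        exact ⟨_, R, ts, rfl⟩
    | imp h1 h2 ih1 ih2 =>
      rw [formulaCode, isQFCode, formulaFold_imp, Bool.and_eq_true]
      exact ⟨ih1, ih2⟩

/-- A theory is decidable if a primitive recursive relation on codes decides satisfiability of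
quantifier-free formulas. -/
theorem isDecidable_of_primrecPred {T : L.Theory} {tm rl : ℕ → Bool} (ptm : Primrec tm)
    (prl : Primrec rl) (htm : ∀ x, tm x = true ↔ ∃ t : L.Term (ℕ ⊕ Fin 0), termCode t = x)
    (hrl : IsRelTest L rl) {p : ℕ → Prop} (pp : PrimrecPred p)
    (hp : ∀ φ : L.Formula ℕ, φ.IsQF → (Satisfiable T φ ↔ p (formulaCode φ))) :
    IsDecidable T := by
  have h : PrimrecPred fun c => isQFCode tm rl c = true ∧ p c :=
    PrimrecPred.and (Primrec.eq.comp (primrec_isQFCode ptm prl) (Primrec.const true)) pp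
  refine h.computablePred.of_eq fun c => ?_
  rw [isQFCode_iff htm hrl]
  constructor
  · rintro ⟨⟨φ, hφ, rfl⟩, h⟩
    exact ⟨φ, hφ, (hp φ hφ).2 h, rfl⟩
  · rintro ⟨φ, hφ, h, rfl⟩
    exact ⟨⟨φ, hφ, rfl⟩, (hp φ hφ).1 h⟩

end Recognition

/-! ### Evaluation in finite interpretations -/

/-- Every function into `{0, …, b - 1}` is given on `{0, …, n - 1}` by the base `b` digits of a
number less than `b ^ n`. -/
theorem exists_digits {b : ℕ} (n : ℕ) (g : ℕ → ℕ) (hg : ∀ x < n, g x < b) :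
    ∃ m < b ^ n, ∀ x < n, m / b ^ x % b = g x := by
  induction n generalizing g with
  | zero => exact ⟨0, by simp, by simp⟩
  | succ n ih =>
    obtain ⟨m, hm, h⟩ := ih (fun x => g (x + 1)) fun x hx => hg _ (by omega)
    have h0 : g 0 < b := hg 0 (by omega)
    -- Horner's scheme: `g 0` is the lowest digit, and the shifted function supplies the higher
    -- ones.
    refine ⟨m * b + g 0, ?_, ?_⟩
    · rw [pow_succ]
      nlinarith
    · rintro (_ | x) hx
      · simp [Nat.mod_eq_of_lt h0]
      · rw [pow_succ', ← Nat.div_div_eq_div_mul, Nat.mul_comm m b,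
          Nat.mul_add_div (by omega), Nat.div_eq_of_lt h0, Nat.add_zero, h x (by omega)]

/-- The base `b` digit of `m` with index `x`. -/
def digit (b m x : ℕ) : ℕ := m / b ^ x % b

theorem primrec_digit : Primrec fun p : ℕ × ℕ × ℕ => digit p.1 p.2.1 p.2.2 :=
  Primrec.nat_mod.comp
    (Primrec.nat_div.comp (Primrec.fst.comp Primrec.snd)
      (primrec_natPow.comp Primrec.fst (Primrec.snd.comp Primrec.snd)))
    Primrec.fst

section Evaluation

variable {L : FirstOrder.Language.{0, 0}} [∀ n, Encodable (L.Functions n)]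
  [∀ n, Encodable (L.Relations n)]

/-- Truth values of codes of quantifier-free formulas, given those of equations and atoms. -/
def evalCode {α : Type} (e : α → ℕ → ℕ → Bool) (r : α → ℕ → Bool) (a : α) (c : ℕ) : Bool :=
  formulaFold false e r (fun x y => !x || y) a c

/-- Subterms and subformulas have smaller codes than the formula, so agreement on codes below `b` is
enough. This is what lets finitely many digits describe an interpretation. -/
theorem evalCode_iff {α : Type} {e : α → ℕ → ℕ → Bool} {r : α → ℕ → Bool} {a : α}
    {M : Type} [L.Structure M] {v : ℕ → M} {b : ℕ}
    (he : ∀ t u : L.Term (ℕ ⊕ Fin 0), termCode t < b → termCode u < b →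
      (e a (termCode t) (termCode u) = true ↔
        t.realize (Sum.elim v default) = u.realize (Sum.elim v default)))
    (hr : ∀ (n : ℕ) (R : L.Relations n) (ts : Fin n → L.Term (ℕ ⊕ Fin 0)),
      Nat.pair (Nat.pair n (Encodable.encode R))
        (Encodable.encode (List.ofFn fun i => termCode (ts i))) < b →
      (r a (Nat.pair (Nat.pair n (Encodable.encode R))
        (Encodable.encode (List.ofFn fun i => termCode (ts i)))) = true ↔
        Structure.RelMap R fun i => (ts i).realize (Sum.elim v default)))
    {φ : L.Formula ℕ} (hφ : φ.IsQF) (hb : formulaCode φ < b) :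
    evalCode e r a (formulaCode φ) = true ↔ φ.Realize v := by
  induction hφ with
  | falsum => exact ⟨fun h => absurd h (by simp [evalCode, formulaCode, formulaFold_zero]), False.elim⟩
  | of_isAtomic h =>
    cases h with
    | equal t u =>
      rw [Term.bdEqual, formulaCode] at hb ⊢
      have h1 := Nat.left_le_pair (termCode t) (termCode u)
      have h2 := Nat.right_le_pair (termCode t) (termCode u)
      rw [evalCode, formulaFold_equal, he t u (by omega) (by omega)]
      rfl
    | rel R ts =>
      rw [Relations.boundedFormula, formulaCode] at hb ⊢
      rw [evalCode, formulaFold_rel, hr _ R ts (by omega)]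
      rfl
  | @imp φ ψ h1 h2 ih1 ih2 =>
    rw [formulaCode] at hb ⊢
    have h1 := Nat.left_le_pair (formulaCode φ) (formulaCode ψ)
    have h2 := Nat.right_le_pair (formulaCode φ) (formulaCode ψ)
    have ih1 := ih1 (by omega)
    have ih2 := ih2 (by omega)
    rw [Formula.Realize, BoundedFormula.realize_imp, ← Formula.Realize, ← Formula.Realize, ← ih1,
      ← ih2, evalCode, formulaFold_imp, ← evalCode, ← evalCode]
    cases evalCode e r a (formulaCode φ) <;> simp

theorem primrec_evalCode {α : Type} [Primcodable α] {e : α → ℕ → ℕ → Bool} {r : α → ℕ → Bool}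
    (he : Primrec fun p : α × ℕ × ℕ => e p.1 p.2.1 p.2.2) (hr : Primrec₂ r) :
    Primrec₂ (evalCode e r) :=
  primrec_formulaFold _ he hr

omit [∀ n, Encodable (L.Relations n)] in
-- One factor 2 is the tag of variables among terms, the other comes from the encoding of `ℕ ⊕ Fin
-- 0`. Hence the tests modulo 4 and the divisions by 4 elsewhere.
theorem termCode_var (x : ℕ) : termCode (L := L) (.var (Sum.inl x : ℕ ⊕ Fin 0)) = 4 * x := by
  rw [termCode, Encodable.encode_inl, Encodable.encode_nat]
  omega

end Evaluation

/-! ### The meaning of the cardinality formulas -/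

section Cardinality

variable {L : FirstOrder.Language.{0, 0}} {M : Type} [L.Structure M]

theorem realize_distinct {n : ℕ} {v : Empty → M} {xs : Fin n → M} :
    (distinct (L := L) n).Realize v xs ↔ Function.Injective xs := by
  simp only [distinct, BoundedFormula.realize_iInf, BoundedFormula.realize_not,
    BoundedFormula.realize_bdEqual, Function.comp_apply, Term.realize_var, Sum.elim_inr, Subtype.forall, Prod.forall]
  constructor
  · intro h i j hij
    by_contra hne
    rcases lt_or_gt_of_ne hne with hlt | hlt
    · exact h i j hlt hij
    · exact h j i hlt hij.symm
  · exact fun h i j hlt hij => hlt.ne (h hij)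

theorem realize_cardExactly {n : ℕ} : M ⊨ (cardExactly n : L.Sentence) ↔ Cardinal.mk M = n := by
  have h1 : M ⊨ (cardAtLeast n : L.Sentence) ↔ ∃ xs : Fin n → M, Function.Injective xs := by
    rw [Sentence.Realize, cardAtLeast, BoundedFormula.realize_exs]
    simp only [realize_distinct]
  have h2 : M ⊨ (cardAtMost n : L.Sentence) ↔ ∃ xs : Fin n → M, Function.Surjective xs := by
    rw [Sentence.Realize, cardAtMost, BoundedFormula.realize_exs]
    simp [Function.Surjective, eq_comm]
  rw [Sentence.Realize, cardExactly, Formula.realize_inf, ← Sentence.Realize, ← Sentence.Realize,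
    h1, h2]
  constructor
  · rintro ⟨⟨xs, hx⟩, ys, hy⟩
    apply le_antisymm
    · simpa using Cardinal.mk_le_of_surjective hy
    · simpa using Cardinal.mk_le_of_injective hx
  · intro h
    rw [← Cardinal.mk_fin] at h
    obtain ⟨e⟩ := Cardinal.eq.1 h
    exact ⟨⟨e.symm, e.symm.injective⟩, e.symm, e.symm.surjective⟩

variable {p : ∀ {k : ℕ}, L.Term (Empty ⊕ Fin k) → L.BoundedFormula Empty k} {s : Set M}

theorem realize_countGe
    (hp : ∀ (k : ℕ) (t : L.Term (Empty ⊕ Fin k)) (v : Empty → M) (xs : Fin k → M),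
      (p t).Realize v xs ↔ t.realize (Sum.elim v xs) ∈ s) {n : ℕ} :
    M ⊨ countGe p n ↔ (n : ℕ∞) ≤ s.encard := by
  rw [Sentence.Realize, countGe, BoundedFormula.realize_exs]
  simp only [BoundedFormula.realize_inf, realize_distinct, BoundedFormula.realize_iInf, hp,
    Function.comp_apply, Term.realize_var, Sum.elim_inr]
  constructor
  · rintro ⟨xs, hinj, hmem⟩
    calc (n : ℕ∞) = (Set.range xs).encard := by simp [← Set.image_univ, hinj.encard_image]
      _ ≤ s.encard := Set.encard_le_encard (Set.range_subset_iff.2 hmem)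
  · intro h
    obtain ⟨t, hts, ht⟩ := Set.exists_subset_encard_eq h
    have : Finite t := Set.finite_of_encard_eq_coe ht
    have hc : Nat.card t = n := by
      have : t.ncard = n := by simp [Set.ncard, ht]
      simpa using this
    let e := Finite.equivFinOfCardEq hc
    exact ⟨fun i => e.symm i, Subtype.val_injective.comp e.symm.injective,
      fun i => hts (e.symm i).2⟩

theorem realize_countEq
    (hp : ∀ (k : ℕ) (t : L.Term (Empty ⊕ Fin k)) (v : Empty → M) (xs : Fin k → M),
      (p t).Realize v xs ↔ t.realize (Sum.elim v xs) ∈ s) {n : ℕ} :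
    M ⊨ countEq p n ↔ s.encard = n := by
  rw [Sentence.Realize, countEq, BoundedFormula.realize_exs]
  simp only [BoundedFormula.realize_inf, realize_distinct, BoundedFormula.realize_iInf, hp,
    Function.comp_apply, Term.realize_var, Sum.elim_inr, BoundedFormula.realize_all, BoundedFormula.realize_imp,
    BoundedFormula.realize_iSup, BoundedFormula.realize_bdEqual, Fin.snoc_last, Fin.snoc_castSucc]
  constructor
  · rintro ⟨xs, ⟨hinj, hmem⟩, hall⟩
    have : s = Set.range xs := by
      apply Set.Subset.antisymm
      · intro x hx
        obtain ⟨i, hi⟩ := hall x hx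
        exact ⟨i, hi.symm⟩
      · exact Set.range_subset_iff.2 hmem
    simp [this, ← Set.image_univ, hinj.encard_image]
  · intro h
    have : Finite s := Set.finite_of_encard_eq_coe h
    have hc : Nat.card s = n := by
      have : s.ncard = n := by simp [Set.ncard, h]
      simpa using this
    let e := Finite.equivFinOfCardEq hc
    refine ⟨fun i => e.symm i, ⟨Subtype.val_injective.comp e.symm.injective,
      fun i => (e.symm i).2⟩, fun x hx => ⟨e ⟨x, hx⟩, by simp⟩⟩

end Cardinality

/-! ### The theory `T_=` -/

theorem model_Teq_iff {M : Type} [sigmaP.Structure M] :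
    M ⊨ Teq ↔ ∀ n : ℕ+, Structure.RelMap (pSymbol n) (![] : Fin 0 → M) →
      Cardinal.mk M = (n : ℕ) := by
  simp only [Theory.model_iff, Teq, Set.forall_mem_range]
  refine forall_congr' fun n => ?_
  rw [Sentence.Realize, Formula.Realize, BoundedFormula.realize_imp]
  have h := realize_cardExactly (L := sigmaP) (M := M) (n := n)
  rw [Sentence.Realize, Formula.Realize] at h
  refine imp_congr ?_ h
  rw [BoundedFormula.Realize]
  exact iff_of_eq (congrArg _ (Subsingleton.elim _ _))

/-- The terms of `Σ_P` are the variables. -/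
theorem sigmaP_term_eq_var (t : sigmaP.Term (ℕ ⊕ Fin 0)) : ∃ x : ℕ, t = .var (Sum.inl x) := by
  cases t with
  | var a =>
    rcases a with x | i
    · exact ⟨x, rfl⟩
    · exact i.elim0
  | func f _ => exact (f : Empty).elim

/-- The interpretation of the symbols of `Σ_P` for which `Pₙ` is true just if `n = b`. -/
@[reducible]
def sigmaPStructure (M : Type) (b : ℕ) : sigmaP.Structure M where
  funMap f := (f : Empty).elim
  RelMap {n} R _ :=
    match n, R with
    | 0, (k : ℕ+) => (k : ℕ) = b
    | _ + 1, R => (R : Empty).elim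

/-! ### Truth in finite Σ_P-interpretations coded by digits -/

/-- The truth value of an equation between variables, for the values given by base `N` digits. -/
def eqP (p : ℕ × ℕ × ℕ) (t u : ℕ) : Bool :=
  decide (digit p.1 p.2.2 (t / 4) = digit p.1 p.2.2 (u / 4))

/-- The truth value of `Pₙ` when only `P_b` is true. -/
def relP (p : ℕ × ℕ × ℕ) (x : ℕ) : Bool :=
  decide (x.unpair.1.unpair.2 + 1 = p.2.1)

theorem primrec_evalCode_sigmaP : Primrec₂ (evalCode eqP relP) := by
  apply primrec_evalCode
  · have h (g : (ℕ × ℕ × ℕ) × ℕ × ℕ → ℕ) (hg : Primrec g) :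
        Primrec fun p : (ℕ × ℕ × ℕ) × ℕ × ℕ => digit p.1.1 p.1.2.2 (g p / 4) :=
      primrec_digit.comp ((Primrec.fst.comp Primrec.fst).pair
        ((Primrec.snd.comp (Primrec.snd.comp Primrec.fst)).pair
          (Primrec.nat_div.comp hg (Primrec.const 4))))
    exact (Primrec.eq.comp (h _ (Primrec.fst.comp Primrec.snd))
      (h _ (Primrec.snd.comp Primrec.snd))).decide
  · exact (Primrec.eq.comp
      (Primrec.succ.comp (Primrec.snd.comp (Primrec.unpair.comp (Primrec.fst.comp
        (Primrec.unpair.comp Primrec.snd)))))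
      (Primrec.fst.comp (Primrec.snd.comp Primrec.fst))).decide

/-- Positive integers are encoded by their predecessors; this accounts for the `+ 1` in `relP`. -/
theorem pNat_encode (n : ℕ+) : Encodable.encode n + 1 = (n : ℕ) :=
  n.natPred_add_one

/-- Without function symbols, truth depends only on which variables are equal and which predicates
hold, so `M` need not have `N` elements. -/
theorem evalCode_sigmaP_iff {N b m B : ℕ} {M : Type} [sigmaP.Structure M] {v : ℕ → M}
    (hv : ∀ x y, x < B → y < B → (digit N m x = digit N m y ↔ v x = v y))
    (hP : ∀ n : ℕ+, (n : ℕ) ≤ B → ((n : ℕ) = b ↔ Structure.RelMap (pSymbol n) (![] : Fin 0 → M)))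
    {φ : sigmaP.Formula ℕ} (hφ : φ.IsQF) (hB : formulaCode φ < B) :
    evalCode eqP relP (N, b, m) (formulaCode φ) = true ↔ φ.Realize v := by
  apply evalCode_iff ?_ ?_ hφ hB
  · intro t u ht hu
    obtain ⟨x, rfl⟩ := sigmaP_term_eq_var t
    obtain ⟨y, rfl⟩ := sigmaP_term_eq_var u
    rw [termCode_var] at ht hu ⊢
    rw [termCode_var]
    simpa [eqP] using hv x y (by omega) (by omega)
  · rintro (_ | n) R ts hR
    · have h1 : Encodable.encode (R : ℕ+) < B :=
        lt_of_le_of_lt ((Nat.right_le_pair 0 _).trans (Nat.left_le_pair _ _)) hR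
      have h2 := pNat_encode R
      have h4 : PNat.val R ≤ B := h2.symm.le.trans (Nat.succ_le_of_lt h1)
      have h3 : (fun i => (ts i).realize (Sum.elim v default)) = (![] : Fin 0 → M) :=
        Subsingleton.elim _ _
      rw [h3]
      refine Iff.trans ?_ (hP R h4)
      rw [← h2]
      simp only [relP, Nat.unpair_pair, decide_eq_true_eq]
      rfl
    · exact (R : Empty).elim

/-- Satisfiability in `T_=` with a domain of cardinality `N`, decided on codes. -/
def SatSize (N c : ℕ) : Prop :=
  -- In a model of size `N` only P_N can hold, so two valuations of the predicates remain: none true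
  -- (index 0, which no P_n has) or P_N alone. The `c + 1` digits of `m` are the values of the
  -- variables with index at most `c`.
  ∃ m < N ^ (c + 1), evalCode eqP relP (N, 0, m) c = true ∨ evalCode eqP relP (N, N, m) c = true

theorem primrecRel_satSize : PrimrecRel SatSize := by
  have h1 : PrimrecRel fun (m : ℕ) (q : ℕ × ℕ) =>
      evalCode eqP relP (q.1, 0, m) q.2 = true ∨ evalCode eqP relP (q.1, q.1, m) q.2 = true := by
    have hN : Primrec fun p : ℕ × ℕ × ℕ => p.2.1 := Primrec.fst.comp Primrec.snd
    have hc : Primrec fun p : ℕ × ℕ × ℕ => p.2.2 := Primrec.snd.comp Primrec.snd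
    refine PrimrecPred.or ?_ ?_
    · exact Primrec.eq.comp (primrec_evalCode_sigmaP.comp
        (hN.pair ((Primrec.const 0).pair Primrec.fst)) hc) (Primrec.const true)
    · exact Primrec.eq.comp (primrec_evalCode_sigmaP.comp
        (hN.pair (hN.pair Primrec.fst)) hc) (Primrec.const true)
  have h2 : Primrec fun p : ℕ × ℕ => p.1 ^ (p.2 + 1) :=
    primrec_natPow.comp Primrec.fst (Primrec.succ.comp Primrec.snd)
  have h3 := (primrecRel_exists_lt h1).comp h2 (Primrec.id (α := ℕ × ℕ))
  exact h3

theorem exists_model_of_satSize {N : ℕ} (hN : 0 < N) {φ : sigmaP.Formula ℕ} (hφ : φ.IsQF)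
    (h : SatSize N (formulaCode φ)) :
    ∃ A : Interpretation sigmaP, A.IsModelOf Teq ∧ A.Satisfies φ ∧ Cardinal.mk A.dom = N := by
  obtain ⟨m, -, h⟩ := h
  obtain ⟨b, hb, h⟩ : ∃ b, (b = 0 ∨ b = N) ∧
      evalCode eqP relP (N, b, m) (formulaCode φ) = true := by
    rcases h with h | h
    exacts [⟨0, .inl rfl, h⟩, ⟨N, .inr rfl, h⟩]
  refine ⟨⟨Fin N, sigmaPStructure (Fin N) b, fun x => ⟨digit N m x, Nat.mod_lt _ hN⟩⟩,
    ?_, ?_, by simp⟩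
  · let := sigmaPStructure (Fin N) b
    refine model_Teq_iff.2 fun n hn => ?_
    have hn : (n : ℕ) = b := hn
    have := n.pos
    rw [Cardinal.mk_fin]
    congr 1
    omega
  · let := sigmaPStructure (Fin N) b
    refine (evalCode_sigmaP_iff (M := Fin N) ?_ ?_ hφ (Nat.lt_succ_self _)).1 h
    · intro x y _ _
      exact Fin.val_inj (a := ⟨digit N m x, Nat.mod_lt _ hN⟩) (b := ⟨digit N m y, Nat.mod_lt _ hN⟩)
    · exact fun n _ => Iff.rfl

/-- If a P_n with n ≤ `formulaCode φ + 1` holds, the whole domain is kept and has n elements.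
Otherwise the domain is cut down to the values of the relevant variables and all predicates are made
false; those of larger index do not occur in `φ`. The size never increases, which later gives
minimality. -/
theorem exists_satSize_of_model {φ : sigmaP.Formula ℕ} (hφ : φ.IsQF) {A : Interpretation sigmaP}
    (hA : A.IsModelOf Teq) (h : A.Satisfies φ) :
    ∃ N, 0 < N ∧ N < formulaCode φ + 2 ∧ (N : Cardinal) ≤ Cardinal.mk A.dom ∧
      SatSize N (formulaCode φ) := by
  let := A.str
  have hA : A.dom ⊨ Teq := hA
  rw [model_Teq_iff] at hA
  have h : φ.Realize A.val := h
  let S : Set A.dom := A.val '' Set.Iio (formulaCode φ + 1)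
  have hSf : S.Finite := (Set.finite_Iio _).image _
  have hS0 : 0 < S.ncard :=
    (Set.ncard_pos hSf).2 ⟨_, Set.mem_image_of_mem _ (Set.mem_Iio.2 (Nat.succ_pos _))⟩
  have hSc : S.ncard ≤ formulaCode φ + 1 :=
    (Set.ncard_image_le (Set.finite_Iio _)).trans (by simp [Set.ncard_eq_toFinset_card'])
  obtain ⟨N, b, V, hbN, hN0, hNc, hSV, hVf, hVN, hP⟩ : ∃ (N b : ℕ) (V : Set A.dom),
      (b = 0 ∨ b = N) ∧ 0 < N ∧ N < formulaCode φ + 2 ∧ S ⊆ V ∧ V.Finite ∧ V.ncard = N ∧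
      ∀ n : ℕ+, (n : ℕ) ≤ formulaCode φ + 1 →
        ((n : ℕ) = b ↔ Structure.RelMap (pSymbol n) (![] : Fin 0 → A.dom)) := by
    by_cases hP : ∃ n : ℕ+, (n : ℕ) ≤ formulaCode φ + 1 ∧
        Structure.RelMap (pSymbol n) (![] : Fin 0 → A.dom)
    · obtain ⟨n, hn, hPn⟩ := hP
      have hc := hA n hPn
      have : Finite A.dom := by
        rw [← Cardinal.lt_aleph0_iff_finite, hc]
        exact Cardinal.natCast_lt_aleph0
      refine ⟨n, n, Set.univ, .inr rfl, n.pos, by omega, Set.subset_univ _, Set.finite_univ, ?_, ?_⟩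
      · rw [Set.ncard_univ, Nat.card, hc, Cardinal.toNat_natCast]
      · intro k hk
        constructor
        · intro hkn
          rwa [PNat.eq hkn]
        · intro hPk
          exact_mod_cast (hA k hPk).symm.trans hc
    · push Not at hP
      exact ⟨S.ncard, 0, S, .inl rfl, hS0, by omega, subset_rfl, hSf, rfl,
        fun n hn => iff_of_false n.pos.ne' (hP n hn)⟩
  refine ⟨N, hN0, hNc, ?_, ?_⟩
  · have := hVf.to_subtype
    rw [← hVN, ← Nat.card_coe_set_eq, Nat.cast_card]
    exact Cardinal.mk_set_le V
  have := hVf.to_subtype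
  let e : V ≃ Fin N := Finite.equivFinOfCardEq (by rw [Nat.card_coe_set_eq, hVN])
  have hmem : ∀ x < formulaCode φ + 1, A.val x ∈ V := fun x hx => hSV ⟨x, hx, rfl⟩
  obtain ⟨m, hm, hd⟩ := exists_digits (b := N) (formulaCode φ + 1)
    (fun x => if hx : x < formulaCode φ + 1 then e ⟨A.val x, hmem x hx⟩ else 0)
    (fun x hx => by simp only [hx, dite_true]; exact Fin.is_lt _)
  refine ⟨m, hm, ?_⟩
  have key : evalCode eqP relP (N, b, m) (formulaCode φ) = true := by
    refine (evalCode_sigmaP_iff ?_ hP hφ (Nat.lt_succ_self _)).2 h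
    intro x y hx hy
    have h1 := hd x hx
    have h2 := hd y hy
    simp only [hx, hy, dite_true] at h1 h2
    rw [digit, digit, h1, h2, Fin.val_inj, e.apply_eq_iff_eq, Subtype.mk.injEq]
  rcases hbN with rfl | rfl
  exacts [.inl key, .inr key]

theorem satisfiable_Teq_iff {φ : sigmaP.Formula ℕ} (hφ : φ.IsQF) :
    Satisfiable Teq φ ↔ ∃ N < formulaCode φ + 2, 0 < N ∧ SatSize N (formulaCode φ) := by
  constructor
  · rintro ⟨A, hA, h⟩
    obtain ⟨N, h0, h1, -, h2⟩ := exists_satSize_of_model hφ hA h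
    exact ⟨N, h1, h0, h2⟩
  · rintro ⟨N, -, h0, h⟩
    obtain ⟨A, hA, h, -⟩ := exists_model_of_satSize h0 hφ h
    exact ⟨A, hA, h⟩

theorem primrecRel_satSize_pos : PrimrecRel fun N c => 0 < N ∧ SatSize N c :=
  PrimrecPred.and (Primrec.nat_lt.comp (Primrec.const 0) Primrec.fst) primrecRel_satSize

theorem isDecidable_Teq : IsDecidable Teq := by
  refine isDecidable_of_primrecPred (tm := fun x => decide (x % 4 = 0))
    (rl := fun x => decide (x.unpair.1.unpair.1 = 0 ∧ x.unpair.2 = 0)) ?_ ?_ ?_ ?_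
    (primrecRel_satSize_pos.exists_lt.comp (Primrec.succ.comp Primrec.succ) Primrec.id)
    (fun φ hφ => satisfiable_Teq_iff hφ)
  · exact (Primrec.eq.comp (Primrec.nat_mod.comp Primrec.id (Primrec.const 4))
      (Primrec.const 0)).decide
  · refine (PrimrecPred.and ?_ ?_).decide
    · exact Primrec.eq.comp (Primrec.fst.comp (Primrec.unpair.comp (Primrec.fst.comp
        Primrec.unpair))) (Primrec.const 0)
    · exact Primrec.eq.comp (Primrec.snd.comp Primrec.unpair) (Primrec.const 0)
  · intro x
    rw [decide_eq_true_eq]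
    constructor
    · intro h
      exact ⟨.var (Sum.inl (x / 4)), by rw [termCode_var]; omega⟩
    · rintro ⟨t, rfl⟩
      obtain ⟨x, rfl⟩ := sigmaP_term_eq_var t
      rw [termCode_var]
      omega
  · intro x
    rw [decide_eq_true_eq]
    constructor
    · rintro ⟨h1, h2⟩
      refine ⟨0, pSymbol x.unpair.1.unpair.2.succPNat, ![], ?_⟩
      have h3 : Encodable.encode (pSymbol x.unpair.1.unpair.2.succPNat) = x.unpair.1.unpair.2 :=
        Nat.natPred_succPNat _
      have h4 : Nat.pair 0 x.unpair.1.unpair.2 = x.unpair.1 := by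
        rw [← h1, Nat.pair_unpair]
      rw [h3, List.ofFn_zero, Encodable.encode_list_nil, h4, ← h2, Nat.pair_unpair]
    · rintro ⟨_ | n, R, ts, rfl⟩
      · simp
      · exact (R : Empty).elim

/-! ### Finite models, minimal models and failure of smoothness -/

theorem hasFiniteModelProperty_Teq : HasFiniteModelProperty Teq := by
  intro φ hφ A hA h
  obtain ⟨N, h0, -, -, h⟩ := exists_satSize_of_model hφ hA h
  obtain ⟨B, hB, h, hc⟩ := exists_model_of_satSize h0 hφ h
  exact ⟨B, hB, h, hc ▸ Cardinal.natCast_lt_aleph0⟩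

theorem hasComputableMinimalModelFunction_Teq : HasComputableMinimalModelFunction Teq := by
  -- `D` is the decision procedure that is known to be primitive recursive, so it is passed
  -- explicitly to the search.
  obtain ⟨D, hdec⟩ : PrimrecPred fun p : ℕ × ℕ => 0 < p.2 ∧ SatSize p.2 p.1 :=
    primrecRel_satSize_pos.comp Primrec.snd Primrec.fst
  -- The least size that works; every model is at least as large as some size that works. On
  -- unsatisfiable formulas the value is irrelevant.
  let g : ℕ → ℕ := fun c =>
    (List.range (c + 2)).findIdx fun N => @decide (0 < N ∧ SatSize N c) (D (c, N))
  have hg : Computable fun c => ((g c : ℕ) : ℕ∞) := by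
    have : Primrec g :=
      Primrec.list_findIdx (Primrec.list_range.comp (Primrec.succ.comp Primrec.succ)) hdec
    exact Computable.option_some.comp this.to_comp
  refine ⟨fun φ => g (formulaCode φ.1), ?_, _, hg, fun φ => rfl⟩
  rintro ⟨φ, hφ⟩ hsat
  obtain ⟨N, hN, hS⟩ := (satisfiable_Teq_iff hφ).1 hsat
  have hlt : g (formulaCode φ) < (List.range (formulaCode φ + 2)).length :=
    List.findIdx_lt_length_of_exists ⟨N, by simpa using hN, by simpa using hS⟩
  have hspec : 0 < g (formulaCode φ) ∧ SatSize (g (formulaCode φ)) (formulaCode φ) := by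
    have h := List.findIdx_getElem (w := hlt)
    rw [List.getElem_range] at h
    exact @of_decide_eq_true _ (D (_, g (formulaCode φ))) h
  constructor
  · obtain ⟨A, hA, h, hc⟩ := exists_model_of_satSize hspec.1 hφ hspec.2
    exact ⟨A, hA, h, by rw [hc]; rfl⟩
  · intro A hA h
    obtain ⟨K, hK0, hKlt, hKA, hKS⟩ := exists_satSize_of_model hφ hA h
    refine le_trans ?_ hKA
    have : g (formulaCode φ) ≤ K := by
      by_contra hlt
      have := List.not_of_lt_findIdx (not_le.1 hlt)
      rw [List.getElem_range] at this
      exact @of_decide_eq_false (_ ∧ _) (D (_, K)) this ⟨hK0, hKS⟩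
    simpa using this

/-- A one-element model of P₁ cannot be enlarged to two elements. -/
theorem not_isSmooth_Teq : ¬ IsSmooth Teq := by
  intro h
  let := sigmaPStructure (Fin 1) 1
  let φ : sigmaP.Formula ℕ := .rel (pSymbol 1) ![]
  have hφ : φ.IsQF := .of_isAtomic (.rel _ _)
  let A : Interpretation sigmaP := ⟨Fin 1, sigmaPStructure (Fin 1) 1, fun _ => 0⟩
  have hA : A.IsModelOf Teq := by
    refine model_Teq_iff.2 fun n hn => ?_
    have hn : (n : ℕ) = 1 := hn
    simp [hn]
  have hAφ : A.Satisfies φ := rfl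
  obtain ⟨B, hB, hBφ, hc⟩ := h φ hφ A hA hAφ 2 (by simp [A])
  let := B.str
  have hB : B.dom ⊨ Teq := hB
  have h1 : Structure.RelMap (pSymbol 1) (![] : Fin 0 → B.dom) := by
    have h2 : Structure.RelMap (pSymbol 1) fun i =>
        Term.realize (Sum.elim B.val default) ((![] : Fin 0 → sigmaP.Term (ℕ ⊕ Fin 0)) i) := hBφ
    rwa [Subsingleton.elim (fun i => Term.realize _ _) (![] : Fin 0 → B.dom)] at h2
  have := model_Teq_iff.1 hB 1 h1
  rw [hc] at this
  norm_num at this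

/-! ### Terms of `Σ_s` -/

/-- The term `s(t)`. -/
def sTerm {α : Type} (t : sigmaS.Term α) : sigmaS.Term α := .func sSymbol ![t]

theorem sigmaS_term_induction {P : sigmaS.Term (ℕ ⊕ Fin 0) → Prop}
    (var : ∀ x : ℕ, P (.var (Sum.inl x))) (app : ∀ t, P t → P (sTerm t))
    (t : sigmaS.Term (ℕ ⊕ Fin 0)) : P t := by
  induction t with
  | var a =>
    rcases a with x | i
    · exact var x
    · exact i.elim0
  | @func n f ts ih =>
    match n, f with
    | 0, f => exact (f : Empty).elim
    | 1, f =>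
      have h : ts = ![ts 0] := by
        ext i
        rw [Subsingleton.elim i 0]
        rfl
      rw [h]
      exact app (ts 0) (ih 0)
    | _ + 2, f => exact (f : Empty).elim

/-- The code of `s(t)` if `u` is that of `t`. -/
def sCode (u : ℕ) : ℕ := 2 * Nat.pair (Nat.pair 1 0) (Nat.pair u 0 + 1) + 1

/-- The code of `t` if `n` is that of `s(t)`. -/
def sArgCode (n : ℕ) : ℕ := ((n / 2).unpair.2 - 1).unpair.1

/-- In `sCode`, `Nat.pair 1 0` stands for the arity and the only unary symbol, and `Nat.pair u 0 +
1` is the encoding of the list `[u]`. -/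
theorem termCode_sTerm (t : sigmaS.Term (ℕ ⊕ Fin 0)) : termCode (sTerm t) = sCode (termCode t) := by
  have h : (List.ofFn fun i : Fin 1 => termCode ((![t] : Fin 1 → sigmaS.Term (ℕ ⊕ Fin 0)) i)) =
      [termCode t] := by simp
  rw [sTerm, termCode, h]
  rfl

theorem sArgCode_sCode (u : ℕ) : sArgCode (sCode u) = u := by
  have h : sCode u / 2 = Nat.pair (Nat.pair 1 0) (Nat.pair u 0 + 1) := by
    rw [sCode]
    omega
  simp [sArgCode, h]

theorem lt_sCode (u : ℕ) : u < sCode u := by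
  have h1 := Nat.left_le_pair u 0
  have h2 := Nat.right_le_pair (Nat.pair 1 0) (Nat.pair u 0 + 1)
  rw [sCode]
  omega

theorem sCode_mod (u : ℕ) : sCode u % 4 ≠ 0 := by
  rw [sCode]
  omega

section TermFold

variable {α σ : Type}

/-- The step of the recursion on codes of `Σ_s`-terms. -/
def sTermStep (d : σ) (v : α → ℕ → σ) (s : α → σ → σ) (a : α) (l : List σ) : σ :=
  if l.length % 4 = 0 then v a (l.length / 4)
  -- Decoding is total, so re-encoding the decoded argument filters out numbers that have not the
  -- shape of a code of s(t).
  else if l.length = sCode (sArgCode l.length) then s a (l.getD (sArgCode l.length) d)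
  else d

/-- Recursion on codes of `Σ_s`-terms; `v` and `s` say what to do with variables and with the
symbol `s`, and `d` is the value for other numbers. -/
def sTermFold (d : σ) (v : α → ℕ → σ) (s : α → σ → σ) (a : α) (n : ℕ) : σ :=
  strongRecValue (sTermStep d v s a) n

theorem primrec_sCode : Primrec sCode :=
  Primrec.succ.comp (Primrec.nat_mul.comp (Primrec.const 2)
    (Primrec₂.natPair.comp (Primrec.const _)
      (Primrec.succ.comp (Primrec₂.natPair.comp Primrec.id (Primrec.const 0)))))

theorem primrec_sArgCode : Primrec sArgCode :=
  Primrec.fst.comp (Primrec.unpair.comp (Primrec.nat_sub.comp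
    (Primrec.snd.comp (Primrec.unpair.comp (Primrec.nat_div.comp Primrec.id (Primrec.const 2))))
    (Primrec.const 1)))

theorem primrec_sTermFold [Primcodable α] [Primcodable σ] (d : σ) {v : α → ℕ → σ}
    {s : α → σ → σ} (hv : Primrec₂ v) (hs : Primrec₂ s) : Primrec₂ (sTermFold d v s) := by
  apply primrec_strongRecValue
  have hl : Primrec fun p : α × List σ => p.2.length := Primrec.list_length.comp Primrec.snd
  have hu := primrec_sArgCode.comp hl
  refine Primrec.ite (Primrec.eq.comp (Primrec.nat_mod.comp hl (Primrec.const 4))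
    (Primrec.const 0)) ?_ ?_
  · exact hv.comp Primrec.fst (Primrec.nat_div.comp hl (Primrec.const 4))
  refine Primrec.ite (Primrec.eq.comp hl (primrec_sCode.comp hu)) ?_ (Primrec.const d)
  exact hs.comp Primrec.fst ((Primrec.list_getD d).comp Primrec.snd hu)

variable (d : σ) (v : α → ℕ → σ) (s : α → σ → σ) (a : α)

theorem sTermFold_var (x : ℕ) : sTermFold d v s a (4 * x) = v a x := by
  rw [sTermFold, strongRecValue_eq]
  simp [sTermStep]

theorem sTermFold_sCode (u : ℕ) :
    sTermFold d v s a (sCode u) = s a (sTermFold d v s a u) := by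
  rw [sTermFold, strongRecValue_eq, sTermStep]
  simp only [List.length_map, List.length_range, sCode_mod, if_false, sArgCode_sCode, if_true,
    getD_map_range _ _ (lt_sCode u)]
  rfl

theorem sTermFold_of_ne {n : ℕ} (h1 : n % 4 ≠ 0) (h2 : n ≠ sCode (sArgCode n)) :
    sTermFold d v s a n = d := by
  rw [sTermFold, strongRecValue_eq, sTermStep]
  simp only [List.length_map, List.length_range, h1, if_false, if_neg h2]

theorem sTermFold_termCode {M : Type} [sigmaS.Structure M] (val : ℕ → M) (d : M)
    (t : sigmaS.Term (ℕ ⊕ Fin 0)) :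
    sTermFold d (fun _ x => val x) (fun _ y => Structure.funMap sSymbol ![y]) () (termCode t) =
      t.realize (Sum.elim val default) := by
  induction t using sigmaS_term_induction with
  | var x => rw [termCode_var, sTermFold_var, Term.realize_var, Sum.elim_inl]
  | app t ih =>
    rw [termCode_sTerm, sTermFold_sCode, ih, sTerm, Term.realize_func]
    congr 1
    ext i
    rw [Subsingleton.elim i 0]
    rfl

end TermFold

/-- The test for codes of `Σ_s`-terms. -/
def isSTermCode (n : ℕ) : Bool :=
  sTermFold false (fun _ _ => true) (fun _ b => b) () n

theorem isSTermCode_iff (n : ℕ) :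
    isSTermCode n = true ↔ ∃ t : sigmaS.Term (ℕ ⊕ Fin 0), termCode t = n := by
  constructor
  · induction n using Nat.strong_induction_on with
    | _ n ih =>
    intro h
    by_cases h1 : n % 4 = 0
    · exact ⟨.var (Sum.inl (n / 4)), by rw [termCode_var]; omega⟩
    by_cases h2 : n = sCode (sArgCode n)
    · rw [h2, isSTermCode, sTermFold_sCode] at h
      obtain ⟨t, ht⟩ := ih (sArgCode n) (lt_of_lt_of_eq (lt_sCode _) h2.symm) h
      exact ⟨sTerm t, by rw [termCode_sTerm, ht, ← h2]⟩
    · rw [isSTermCode, sTermFold_of_ne _ _ _ _ h1 h2] at h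
      exact absurd h (by decide)
  · rintro ⟨t, rfl⟩
    induction t using sigmaS_term_induction with
    | var x => rw [termCode_var, isSTermCode, sTermFold_var]
    | app t ih => rwa [termCode_sTerm, isSTermCode, sTermFold_sCode]

/-! ### Models of `T_f` -/

section ModelsTf

/-- The elements `x` with `s(x) = x`. -/
def fixedSet (M : Type) [sigmaS.Structure M] : Set M :=
  {x | Structure.funMap sSymbol ![x] = x}

variable {M : Type} [sigmaS.Structure M]

theorem realize_sTerm {α : Type} (t : sigmaS.Term α) (v : α → M) :
    (sTerm t).realize v = Structure.funMap sSymbol ![t.realize v] := by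
  rw [sTerm, Term.realize_func]
  congr 1
  ext i
  rw [Subsingleton.elim i 0]
  rfl

theorem realize_fixedBy (k : ℕ) (t : sigmaS.Term (Empty ⊕ Fin k)) (v : Empty → M)
    (xs : Fin k → M) :
    (fixedBy t).Realize v xs ↔ t.realize (Sum.elim v xs) ∈ fixedSet M := by
  rw [fixedBy, BoundedFormula.realize_bdEqual, ← sTerm, realize_sTerm]
  rfl

theorem realize_movedBy (k : ℕ) (t : sigmaS.Term (Empty ⊕ Fin k)) (v : Empty → M)
    (xs : Fin k → M) :
    (movedBy t).Realize v xs ↔ t.realize (Sum.elim v xs) ∈ (fixedSet M)ᶜ := by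
  rw [movedBy, BoundedFormula.realize_not, realize_fixedBy, Set.mem_compl_iff]

theorem model_Tf_iff {f : ℕ+ → Bool} :
    M ⊨ Tf f ↔ ∀ k : ℕ+,
      (countValues f true k ≤ (fixedSet M).encard ∧
        countValues f false k ≤ (fixedSet M)ᶜ.encard) ∨
      ∃ i ≤ k, (fixedSet M).encard = countValues f true i ∧
        (fixedSet M)ᶜ.encard = countValues f false i := by
  simp only [Theory.model_iff, Tf, Set.forall_mem_range]
  refine forall_congr' fun k => ?_
  have h1 := fun n => realize_countGe (n := n) (realize_fixedBy (M := M))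
  have h2 := fun n => realize_countGe (n := n) (realize_movedBy (M := M))
  have h3 := fun n => realize_countEq (n := n) (realize_fixedBy (M := M))
  have h4 := fun n => realize_countEq (n := n) (realize_movedBy (M := M))
  simp only [Sentence.Realize, Formula.Realize] at h1 h2 h3 h4
  rw [Sentence.Realize, Formula.Realize, axiomTf]
  simp only [BoundedFormula.realize_sup, BoundedFormula.realize_inf, BoundedFormula.realize_iSup,
    h1, h2, h3, h4, Subtype.exists, exists_prop]

end ModelsTf

/-! ### Decidability of `T_f` -/

/-- The value of a `Σ_s`-term in a finite interpretation given by base `p.1` digits. -/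
def evalSTerm (p : ℕ × ℕ × ℕ) (t : ℕ) : ℕ :=
  sTermFold 0 (fun p x => digit p.1 p.2.1 x) (fun p y => digit p.1 p.2.2 y) p t

/-- The truth value of an equation between `Σ_s`-terms in such an interpretation. -/
def eqS (p : ℕ × ℕ × ℕ) (t u : ℕ) : Bool :=
  decide (evalSTerm p t = evalSTerm p u)

theorem primrec_evalCode_sigmaS : Primrec₂ (evalCode eqS fun _ _ => false) := by
  have h : Primrec₂ evalSTerm := by
    apply primrec_sTermFold
    · exact primrec_digit.comp ((Primrec.fst.comp Primrec.fst).pair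
        ((Primrec.fst.comp (Primrec.snd.comp Primrec.fst)).pair Primrec.snd))
    · exact primrec_digit.comp ((Primrec.fst.comp Primrec.fst).pair
        ((Primrec.snd.comp (Primrec.snd.comp Primrec.fst)).pair Primrec.snd))
  apply primrec_evalCode
  · exact (Primrec.eq.comp (h.comp Primrec.fst (Primrec.fst.comp Primrec.snd))
      (h.comp Primrec.fst (Primrec.snd.comp Primrec.snd))).decide
  · exact Primrec.const false

theorem evalCode_sigmaS_iff {p : ℕ × ℕ × ℕ} {M : Type} [sigmaS.Structure M] {v : ℕ → M}
    {φ : sigmaS.Formula ℕ} (hφ : φ.IsQF)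
    (h : ∀ t u : sigmaS.Term (ℕ ⊕ Fin 0), termCode t < formulaCode φ + 1 →
      termCode u < formulaCode φ + 1 →
      (evalSTerm p (termCode t) = evalSTerm p (termCode u) ↔
        t.realize (Sum.elim v default) = u.realize (Sum.elim v default))) :
    evalCode eqS (fun _ _ => false) p (formulaCode φ) = true ↔ φ.Realize v := by
  refine evalCode_iff (fun t u ht hu => ?_) (fun n R => (R : Empty).elim) hφ (Nat.lt_succ_self _)
  rw [eqS, decide_eq_true_eq, h t u ht hu]

/-- Satisfiability of quantifier-free `Σ_s`-formulas, decided on codes. -/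
def SatS (c : ℕ) : Prop :=
  -- The digits of `m` give the variables and those of `m'` give `s`. A domain of `c + 1` elements
  -- suffices because elements get named by codes of terms, which are at most `c`.
  ∃ m < (c + 1) ^ (c + 1), ∃ m' < (c + 1) ^ (c + 1),
    evalCode eqS (fun _ _ => false) (c + 1, m, m') c = true

theorem primrecPred_satS : PrimrecPred SatS := by
  have hpow : Primrec fun c : ℕ => (c + 1) ^ (c + 1) :=
    primrec_natPow.comp Primrec.succ Primrec.succ
  have h1 : PrimrecRel fun (m' : ℕ) (q : ℕ × ℕ) =>
      evalCode eqS (fun _ _ => false) (q.2 + 1, q.1, m') q.2 = true := by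
    have hc : Primrec fun p : ℕ × ℕ × ℕ => p.2.2 := Primrec.snd.comp Primrec.snd
    exact Primrec.eq.comp (primrec_evalCode_sigmaS.comp ((Primrec.succ.comp hc).pair
      ((Primrec.fst.comp Primrec.snd).pair Primrec.fst)) hc) (Primrec.const true)
  have h2 : PrimrecRel fun m c : ℕ => ∃ m' < (c + 1) ^ (c + 1),
      evalCode eqS (fun _ _ => false) (c + 1, m, m') c = true :=
    (primrecRel_exists_lt h1).comp (hpow.comp Primrec.snd) (Primrec.id (α := ℕ × ℕ))
  exact (primrecRel_exists_lt h2).comp hpow Primrec.id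

/-- Each term value is named by the least number that `e`, the extension of term evaluation to all
numbers, maps to it. A term with code n has a value with name at most n, so names of relevant values
stay below `c + 1`; distinct values have distinct names, and `m'` makes `s` act on names. -/
theorem satS_of_realize {M : Type} [sigmaS.Structure M] {v : ℕ → M} {φ : sigmaS.Formula ℕ}
    (hφ : φ.IsQF) (h : φ.Realize v) : SatS (formulaCode φ) := by
  obtain ⟨c, hc⟩ : ∃ c, formulaCode φ = c := ⟨_, rfl⟩
  let e : ℕ → M :=
    sTermFold (v 0) (fun _ x => v x) (fun _ y => Structure.funMap sSymbol ![y]) ()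
  have he : ∀ t : sigmaS.Term (ℕ ⊕ Fin 0), e (termCode t) = t.realize (Sum.elim v default) :=
    sTermFold_termCode v (v 0)
  let k : M → ℕ := fun x => sInf {n | e n = x}
  have hk : ∀ n, k (e n) ≤ n := fun n => Nat.sInf_le rfl
  have hek : ∀ n, e (k (e n)) = e n := fun n => Nat.sInf_mem (s := {m | e m = e n}) ⟨n, rfl⟩
  -- Names that are too large become 0; the evaluation of terms with code at most `c` never meets
  -- them.
  let trunc : ℕ → ℕ := fun n => if n < c + 1 then n else 0
  have htrunc : ∀ n, trunc n < c + 1 := by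
    intro n
    simp only [trunc]
    split_ifs <;> omega
  have htrunc' : ∀ n < c + 1, trunc n = n := fun n hn => if_pos hn
  obtain ⟨m, hm, hmd⟩ := exists_digits (b := c + 1) (c + 1) (fun x => trunc (k (v x)))
    fun x _ => htrunc _
  obtain ⟨m', hm', hmd'⟩ := exists_digits (b := c + 1) (c + 1)
    (fun y => trunc (k (Structure.funMap sSymbol ![e y]))) fun x _ => htrunc _
  have key : ∀ t : sigmaS.Term (ℕ ⊕ Fin 0), termCode t < c + 1 →
      evalSTerm (c + 1, m, m') (termCode t) = k (e (termCode t)) := by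
    intro t
    induction t using sigmaS_term_induction with
    | var x =>
      intro hx
      have hex : e (4 * x) = v x := sTermFold_var _ _ _ _ x
      rw [termCode_var] at hx ⊢
      have := hk (4 * x)
      rw [evalSTerm, sTermFold_var, digit, hmd x (by omega), ← hex, htrunc' _ (by omega)]
    | app t ih =>
      intro ht
      rw [termCode_sTerm] at ht ⊢
      have h1 := lt_sCode (termCode t)
      have h2 := hk (termCode t)
      have h3 := hk (sCode (termCode t))
      have h4 : e (sCode (termCode t)) = Structure.funMap sSymbol ![e (termCode t)] :=
        sTermFold_sCode _ _ _ _ _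
      rw [evalSTerm, sTermFold_sCode, ← evalSTerm, ih (by omega), digit, hmd' _ (by omega), hek,
        ← h4, htrunc' _ (by omega)]
  rw [hc]
  refine ⟨m, hm, m', hm', ?_⟩
  rw [← hc] at key ⊢
  refine (evalCode_sigmaS_iff hφ fun t u ht hu => ?_).2 h
  rw [key t ht, key u hu, ← he, ← he]
  constructor
  · intro h
    rw [← hek (termCode t), h, hek]
  · exact fun h => by rw [h]

/-- The interpretation of `s` on `ℕ` given by base `b` digits on the numbers less than `b`, with
infinitely many other elements that are fixed and infinitely many that are moved. -/
@[reducible]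
def sigmaSStructure (b m : ℕ) : sigmaS.Structure ℕ where
  funMap {n} f :=
    match n, f with
    | 0, f => (f : Empty).elim
    | 1, _ => fun xs => if xs 0 < b then digit b m (xs 0) else if Even (xs 0) then xs 0 else xs 0 + 1
    | _ + 2, f => (f : Empty).elim
  RelMap R := (R : Empty).elim

/-- The numbers below `b` are closed under `s`, so they carry the evaluation of all terms. Beyond
`b`, even numbers are fixed and odd ones moved; both sets are infinite, so the first disjunct of
every axiom holds, whatever `f` is. -/
theorem satisfiable_Tf_of_satS {f : ℕ+ → Bool} {φ : sigmaS.Formula ℕ} (hφ : φ.IsQF)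
    (h : SatS (formulaCode φ)) : Satisfiable (Tf f) φ := by
  obtain ⟨m, -, m', -, h⟩ := h
  obtain ⟨b, hb0, hb⟩ : ∃ b, 0 < b ∧ formulaCode φ + 1 = b := ⟨_, Nat.succ_pos _, rfl⟩
  rw [hb] at h
  let := sigmaSStructure b m'
  have hs : ∀ x : ℕ, (Structure.funMap sSymbol ![x] : ℕ) =
    if x < b then digit b m' x else if Even x then x else x + 1 := fun x => rfl
  refine ⟨⟨ℕ, sigmaSStructure b m', digit b m⟩, ?_, ?_⟩
  · refine model_Tf_iff.2 fun k => .inl ?_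
    have h1 : (fixedSet ℕ).Infinite := by
      refine Set.infinite_of_injective_forall_mem (f := fun n : ℕ => 2 * (n + b))
        (fun x y hxy => by simpa using hxy) fun n => ?_
      rw [fixedSet, Set.mem_ofPred_eq, hs, if_neg (by omega), if_pos (even_two_mul _)]
    have h2 : (fixedSet ℕ)ᶜ.Infinite := by
      refine Set.infinite_of_injective_forall_mem (f := fun n : ℕ => 2 * (n + b) + 1)
        (fun x y hxy => by simpa using hxy) fun n => ?_
      rw [Set.mem_compl_iff, fixedSet, Set.mem_ofPred_eq, hs, if_neg (by omega),
        if_neg (Nat.not_even_two_mul_add_one _)]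
      omega
    rw [h1.encard_eq, h2.encard_eq]
    exact ⟨le_top, le_top⟩
  · refine (evalCode_sigmaS_iff (M := ℕ) hφ fun t u _ _ => ?_).1 h
    have key (d : Fin 0 → ℕ) : ∀ t : sigmaS.Term (ℕ ⊕ Fin 0),
        evalSTerm (b, m, m') (termCode t) < b ∧
          evalSTerm (b, m, m') (termCode t) = t.realize (Sum.elim (digit b m) d) := by
      intro t
      induction t using sigmaS_term_induction with
      | var x =>
        rw [termCode_var, evalSTerm, sTermFold_var]
        exact ⟨Nat.mod_lt _ hb0, rfl⟩
      | app t ih =>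
        rw [termCode_sTerm, evalSTerm, sTermFold_sCode, ← evalSTerm]
        refine ⟨Nat.mod_lt _ hb0, ?_⟩
        rw [realize_sTerm, hs, ← ih.2, if_pos ih.1]
    exact Eq.congr (key _ t).2 (key _ u).2

theorem isDecidable_Tf (f : ℕ+ → Bool) : IsDecidable (Tf f) := by
  refine isDecidable_of_primrecPred (tm := isSTermCode) (rl := fun _ => false) ?_
    (Primrec.const false) isSTermCode_iff ?_ primrecPred_satS ?_
  · exact (primrec_sTermFold (α := Unit) false (v := fun _ _ => true) (s := fun _ b => b)
      (Primrec.const true) Primrec.snd).comp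
      (Primrec.const ()) Primrec.id
  · exact fun x => iff_of_false Bool.false_ne_true fun ⟨n, R, _⟩ => (R : Empty).elim
  · intro φ hφ
    constructor
    · rintro ⟨A, -, h⟩
      let := A.str
      exact satS_of_realize hφ h
    · exact satisfiable_Tf_of_satS hφ

/-! ### Injectivity of the Gödel numbering -/

section Injectivity

variable {L : FirstOrder.Language.{0, 0}} [∀ n, Encodable (L.Functions n)]

theorem termCode_injective {α : Type} [Encodable α] :
    Function.Injective (termCode : L.Term α → ℕ) := by
  intro t
  induction t with
  | var a =>
    intro u h
    cases u with
    | var b =>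
      simp only [termCode] at h
      rw [Encodable.encode_injective (Nat.eq_of_mul_eq_mul_left two_pos h)]
    | func g us =>
      simp only [termCode] at h
      omega
  | @func n g ts ih =>
    intro u h
    cases u with
    | var b =>
      simp only [termCode] at h
      omega
    | @func k g' us =>
      simp only [termCode] at h
      have h := Nat.pair_eq_pair.1 (Nat.eq_of_mul_eq_mul_left two_pos (Nat.add_right_cancel h))
      obtain ⟨h1, h2⟩ := h
      obtain ⟨rfl, h1⟩ := Nat.pair_eq_pair.1 h1
      obtain rfl := Encodable.encode_injective h1
      have h2 := List.ofFn_injective (Encodable.encode_injective h2)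
      congr 1
      funext i
      exact ih i (congrFun h2 i)

/-- `IsDecidable` speaks only of codes; injectivity allows an answer about a code to be read as an
answer about the formula itself. -/
theorem formulaCode_injective [∀ n, Encodable (L.Relations n)] {k : ℕ} :
    Function.Injective (formulaCode : L.BoundedFormula ℕ k → ℕ) := by
  intro φ
  induction φ with
  | falsum => intro ψ h; cases ψ <;> simp only [formulaCode] at h <;> first | rfl | omega
  | equal t u =>
    intro ψ h
    cases ψ <;> simp only [formulaCode] at h <;> try omega
    have h := Nat.pair_eq_pair.1 (Nat.eq_of_mul_eq_mul_left four_pos (Nat.add_right_cancel h))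
    rw [termCode_injective h.1, termCode_injective h.2]
  | rel R ts =>
    intro ψ h
    cases ψ <;> simp only [formulaCode] at h <;> try omega
    have h := Nat.pair_eq_pair.1 (Nat.eq_of_mul_eq_mul_left four_pos (Nat.add_right_cancel h))
    obtain ⟨h1, h2⟩ := h
    obtain ⟨rfl, h1⟩ := Nat.pair_eq_pair.1 h1
    obtain rfl := Encodable.encode_injective h1
    have h2 := List.ofFn_injective (Encodable.encode_injective h2)
    congr 1
    funext i
    exact termCode_injective (congrFun h2 i)
  | imp φ ψ ih1 ih2 =>
    intro χ h
    cases χ <;> simp only [formulaCode] at h <;> try omega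
    have h := Nat.pair_eq_pair.1 (Nat.eq_of_mul_eq_mul_left four_pos (Nat.add_right_cancel h))
    rw [ih1 h.1, ih2 h.2]
  | all φ ih =>
    intro χ h
    cases χ <;> simp only [formulaCode] at h <;> try omega
    rw [ih (Nat.eq_of_mul_eq_mul_left four_pos (Nat.add_right_cancel h))]

end Injectivity

/-! ### Counting values -/

section Counting

variable (f : ℕ+ → Bool) (b : Bool)

theorem countValues_eq_count (k : ℕ+) :
    countValues f b k = Nat.count (fun i => f i.succPNat = b) k := by
  rw [countValues, Nat.count_eq_card_filter_range]
  refine Finset.card_bij' (fun i _ => i.natPred) (fun i _ => i.succPNat) ?_ ?_ ?_ ?_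
  · intro i hi
    simp only [Finset.mem_filter, Finset.mem_Icc, Finset.mem_range, PNat.succPNat_natPred] at hi ⊢
    refine ⟨?_, hi.2⟩
    have h1 : (i : ℕ) ≤ k := hi.1.2
    have h2 := i.natPred_add_one
    omega
  · intro i hi
    simp only [Finset.mem_filter, Finset.mem_Icc, Finset.mem_range] at hi ⊢
    exact ⟨⟨one_le, PNat.coe_le_coe _ _ |>.1 (by simpa using hi.1)⟩, hi.2⟩
  · simp
  · simp

theorem countValues_mono {j k : ℕ+} (h : j ≤ k) : countValues f b j ≤ countValues f b k := by
  rw [countValues_eq_count, countValues_eq_count]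
  exact Nat.count_monotone _ h

theorem countValues_add (k : ℕ+) : countValues f true k + countValues f false k = k := by
  rw [countValues_eq_count, countValues_eq_count]
  induction (k : ℕ) with
  | zero => rfl
  | succ n ih =>
    rw [Nat.count_succ, Nat.count_succ]
    cases h : f n.succPNat <;> simp <;> omega

theorem countValues_succ (n : ℕ) :
    countValues f b (n + 1).succPNat =
      countValues f b n.succPNat + if f (n + 1).succPNat = b then 1 else 0 := by
  rw [countValues_eq_count, countValues_eq_count, Nat.succPNat_coe, Nat.succPNat_coe,
    Nat.count_succ]

theorem countValues_one : countValues f b 1 = if f 1 = b then 1 else 0 := by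
  rw [countValues_eq_count, PNat.one_coe, Nat.count_succ, Nat.count_zero, zero_add]
  rfl

end Counting

/-! ### Existence of admissible functions -/

/-- Counting positions from 0, positions 2m and 2m + 1 carry `g m` and its negation, which balances
every prefix of even length. Here `g 0` is true, so that f(1) = 1, and the later values of `g` solve
the halting problem on input 0. -/
theorem exists_isAdmissible : ∃ f : ℕ+ → Bool, IsAdmissible f := by
  classical
  let g : ℕ → Bool
    | 0 => true
    | j + 1 => decide ((Nat.Partrec.Code.eval (Denumerable.ofNat Nat.Partrec.Code j) 0).Dom)
  let f : ℕ+ → Bool := fun i => if i.natPred % 2 = 0 then g (i.natPred / 2) else !g (i.natPred / 2)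
  refine ⟨f, ?_, rfl, ?_⟩
  · intro hf
    apply ComputablePred.halting_problem 0
    have h : Computable fun c : Nat.Partrec.Code => f (2 * (Encodable.encode c + 1)).succPNat :=
      hf.comp ((Computable.ofNat ℕ+).comp
        (Primrec.nat_mul.comp (Primrec.const 2) (Primrec.succ.comp Primrec.encode)).to_comp)
    refine ComputablePred.computable_iff.2 ⟨_, h, ?_⟩
    funext c
    simp [f, g]
  · have key : ∀ (b : Bool) (m : ℕ), Nat.count (fun i => f i.succPNat = b) (2 * m) = m := by
      intro b m
      induction m with
      | zero => rfl
      | succ m ih =>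
        rw [Nat.mul_succ, Nat.count_succ, Nat.count_succ, ih]
        have h1 : f (2 * m).succPNat = g m := by simp [f]
        have h2 : f (2 * m + 1).succPNat = !g m := by
          have h3 : (2 * m + 1) % 2 = 1 := by omega
          have h4 : (2 * m + 1) / 2 = m := by omega
          simp [f, h3, h4]
        rw [h1, h2]
        cases g m <;> cases b <;> rfl
    intro k hk
    obtain ⟨k, rfl⟩ := Nat.exists_eq_add_of_le' hk
    rw [countValues_eq_count, countValues_eq_count, PNat.pow_coe, pow_succ']
    exact (key true _).trans (key false _).symm

/-! ### Undecidability of the combination -/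

/-- The joint signature of `T_f` and `T_=`. -/
abbrev sigmaSP : FirstOrder.Language.{0, 0} := sigmaS.sum sigmaP

/-- The symbol `s` of the joint signature. -/
def jointSSymbol : sigmaSP.Functions 1 := Sum.inl sSymbol

/-- The symbol `Pₙ` of the joint signature. -/
def jointPSymbol (n : ℕ+) : sigmaSP.Relations 0 := Sum.inr (pSymbol n)

/-- The equation `x_i = x_j`. -/
def varEq (i j : ℕ) : sigmaSP.Formula ℕ :=
  .equal (.var (Sum.inl i)) (.var (Sum.inl j))

/-- The equation `s(x_i) = x_i`. -/
def varFixed (i : ℕ) : sigmaSP.Formula ℕ :=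
  .equal (.func jointSSymbol ![.var (Sum.inl i)]) (.var (Sum.inl i))

/-- `x_0, …, x_{j - 1}` are different from `x_i`, implies `φ`. -/
def distinctImp (i : ℕ) (φ : sigmaSP.Formula ℕ) : ℕ → sigmaSP.Formula ℕ
  | 0 => φ
  | j + 1 => .imp (.imp (varEq j i) .falsum) (distinctImp i φ j)

/-- `x_0, …, x_{k - 1}` are not distinct fixed points of `s`. -/
def notFixedPoints : ℕ → sigmaSP.Formula ℕ
  | 0 => .falsum
  | k + 1 => .imp (varFixed k) (distinctImp k (notFixedPoints k) k)

/-- `P_n` holds and `x_0, …, x_{k - 1}` are distinct fixed points of `s`. -/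
def sizeAndFixedPoints (n : ℕ+) (k : ℕ) : sigmaSP.Formula ℕ :=
  -- Only the primitive connectives → and ⊥ are used, so the Gödel number can be computed directly.
  .imp (.imp (.rel (jointPSymbol n) ![]) (notFixedPoints k)) .falsum

section Realize

variable {M : Type} [sigmaS.Structure M] [sigmaP.Structure M] {v : ℕ → M}

theorem realize_varEq (i j : ℕ) : (varEq i j).Realize v ↔ v i = v j := Iff.rfl

theorem realize_varFixed (i : ℕ) : (varFixed i).Realize v ↔ v i ∈ fixedSet M := by
  have h : (fun k => Term.realize (Sum.elim v default)
      ((![.var (Sum.inl i)] : Fin 1 → sigmaSP.Term (ℕ ⊕ Fin 0)) k)) = ![v i] := by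
    funext k
    rw [Subsingleton.elim k 0]
    rfl
  have h' : (varFixed i).Realize v ↔ Structure.funMap (L := sigmaS) sSymbol
      (fun k => Term.realize (Sum.elim v default)
      ((![.var (Sum.inl i)] : Fin 1 → sigmaSP.Term (ℕ ⊕ Fin 0)) k)) = v i := Iff.rfl
  rw [h', h]
  rfl

theorem realize_distinctImp (i : ℕ) (φ : sigmaSP.Formula ℕ) (j : ℕ) :
    (distinctImp i φ j).Realize v ↔ ((∀ k < j, v k ≠ v i) → φ.Realize v) := by
  induction j with
  | zero => simp [distinctImp]
  | succ j ih =>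
    have h : (distinctImp i φ (j + 1)).Realize v ↔
        (((varEq j i).Realize v → False) → (distinctImp i φ j).Realize v) := Iff.rfl
    rw [h, ih, realize_varEq, Nat.forall_lt_succ_right]
    tauto

theorem realize_notFixedPoints (k : ℕ) :
    (notFixedPoints k).Realize v ↔
      ¬ ∀ i < k, v i ∈ fixedSet M ∧ ∀ j < i, v j ≠ v i := by
  induction k with
  | zero => exact iff_of_false id (by simp)
  | succ k ih =>
    have h : (notFixedPoints (k + 1)).Realize v ↔ ((varFixed k).Realize v →
        (distinctImp k (notFixedPoints k) k).Realize v) := Iff.rfl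
    rw [h, realize_varFixed, realize_distinctImp, ih, Nat.forall_lt_succ_right]
    tauto

theorem realize_sizeAndFixedPoints (n : ℕ+) (k : ℕ) :
    (sizeAndFixedPoints n k).Realize v ↔ Structure.RelMap (pSymbol n) (![] : Fin 0 → M) ∧
      ∀ i < k, v i ∈ fixedSet M ∧ ∀ j < i, v j ≠ v i := by
  have h : (sizeAndFixedPoints n k).Realize v ↔
      ((Structure.RelMap (pSymbol n) (fun i => Term.realize (Sum.elim v default)
        ((![] : Fin 0 → sigmaSP.Term (ℕ ⊕ Fin 0)) i)) → (notFixedPoints k).Realize v) → False) :=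
    Iff.rfl
  rw [h, realize_notFixedPoints,
    Subsingleton.elim (fun i => Term.realize _ _) (![] : Fin 0 → M)]
  exact ⟨fun h => by_contra fun h' => h fun hp hq => h' ⟨hp, hq⟩, fun h h' => h' h.1 h.2⟩

end Realize

theorem isQF_sizeAndFixedPoints (n : ℕ+) (k : ℕ) : (sizeAndFixedPoints n k).IsQF := by
  have h1 : ∀ (i : ℕ) (φ : sigmaSP.Formula ℕ), φ.IsQF → ∀ j, (distinctImp i φ j).IsQF := by
    intro i φ hφ j
    induction j with
    | zero => exact hφ
    | succ j ih => exact .imp (.imp (.of_isAtomic (.equal _ _)) .falsum) ih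
  have h2 : (notFixedPoints k).IsQF := by
    induction k with
    | zero => exact .falsum
    | succ k ih => exact .imp (.of_isAtomic (.equal _ _)) (h1 _ _ ih _)
  exact .imp (.imp (.of_isAtomic (.rel _ _)) h2) .falsum

theorem model_combine_iff {M : Type} [sigmaS.Structure M] [sigmaP.Structure M]
    {T₁ : sigmaS.Theory} {T₂ : sigmaP.Theory} :
    M ⊨ combine T₁ T₂ ↔ M ⊨ T₁ ∧ M ⊨ T₂ := by
  rw [combine, Theory.model_union_iff, LHom.onTheory_model, LHom.onTheory_model]

/-- In the axiom with index n, the two lower bounds add up to n and must both be attained, while an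
exact pair with index i adds up to i and forces i = n. -/
theorem encard_fixedSet_of_model {f : ℕ+ → Bool} {n : ℕ+} {M : Type} [sigmaS.Structure M]
    (hM : M ⊨ Tf f) (hn : Cardinal.mk M = (n : ℕ)) :
    (fixedSet M).encard = countValues f true n := by
  have hfin : Finite M := by
    rw [← Cardinal.lt_aleph0_iff_finite, hn]
    exact Cardinal.natCast_lt_aleph0
  have hcard : (fixedSet M).ncard + (fixedSet M)ᶜ.ncard = n := by
    rw [Set.ncard_add_ncard_compl, Nat.card, hn, Cardinal.toNat_natCast]
  have h := model_Tf_iff.1 hM n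
  rw [← (Set.toFinite (fixedSet M)).cast_ncard_eq,
    ← (Set.toFinite (fixedSet M)ᶜ).cast_ncard_eq] at h
  rw [← (Set.toFinite (fixedSet M)).cast_ncard_eq]
  norm_cast at h ⊢
  rcases h with ⟨h1, h2⟩ | ⟨i, -, h1, h2⟩
  · have := countValues_add f n
    omega
  · have := countValues_add f i
    have hi : i = n := PNat.eq (by omega)
    rw [h1, hi]

/-- The interpretation of `s` on `Fin n` with fixed points `0, …, a - 1`. -/
@[reducible]
def sigmaSFinStructure (n : ℕ+) (a : ℕ) : sigmaS.Structure (Fin n) where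
  funMap {k} f :=
    match k, f with
    | 0, f => (f : Empty).elim
    | 1, _ => fun xs => if (xs 0 : ℕ) < a then xs 0 else ⟨0, n.pos⟩
    | _ + 2, f => (f : Empty).elim
  RelMap R := (R : Empty).elim

theorem mem_fixedSet_sigmaSFinStructure {n : ℕ+} {a : ℕ} (ha : 0 < a) (x : Fin n) :
    letI := sigmaSFinStructure n a
    x ∈ fixedSet (Fin n) ↔ (x : ℕ) < a := by
  have h : (letI := sigmaSFinStructure n a; x ∈ fixedSet (Fin n)) ↔
      (if (x : ℕ) < a then x else ⟨0, n.pos⟩) = x := Iff.rfl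
  refine h.trans ?_
  split_ifs with hx
  · simp [hx]
  · refine iff_of_false (fun h0 => hx ?_) hx
    rw [← h0]
    exact ha

/-- P_n forces size n, hence exactly f₁(n) fixed points. Conversely, `Fin n` with f₁(n) fixed points
is a model of both theories. -/
theorem satisfiable_sizeAndFixedPoints_iff {f : ℕ+ → Bool} (hf : f 1 = true) (n : ℕ+) (k : ℕ) :
    Satisfiable (combine (Tf f) Teq) (sizeAndFixedPoints n k) ↔ k ≤ countValues f true n := by
  constructor
  · rintro ⟨A, hA, h⟩
    let := A.str
    let : sigmaS.Structure A.dom := (LHom.sumInl : sigmaS →ᴸ sigmaSP).reduct A.dom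
    let : sigmaP.Structure A.dom := (LHom.sumInr : sigmaP →ᴸ sigmaSP).reduct A.dom
    -- Any structure for the joint signature is the sum of its two reducts.
    have hstr : A.str = sigmaS.sumStructure sigmaP A.dom := by
      ext n s xs
      · rcases s with s | s <;> rfl
      · rcases s with s | s <;> rfl
    have hA : @Theory.Model sigmaSP A.dom (sigmaS.sumStructure sigmaP A.dom)
        (combine (Tf f) Teq) := hstr ▸ hA
    have h : @Formula.Realize sigmaSP A.dom (sigmaS.sumStructure sigmaP A.dom) ℕ
        (sizeAndFixedPoints n k) A.val := hstr ▸ h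
    obtain ⟨h1, h2⟩ := model_combine_iff.1 hA
    obtain ⟨hP, hv⟩ := (realize_sizeAndFixedPoints n k).1 h
    have hc := encard_fixedSet_of_model h1 (model_Teq_iff.1 h2 n hP)
    have hinj : Function.Injective fun i : Fin k => A.val i := by
      intro i j hij
      by_contra hne
      rcases lt_or_gt_of_ne hne with hlt | hlt
      · exact (hv j j.2).2 i hlt hij
      · exact (hv i i.2).2 j hlt hij.symm
    have hle : (k : ℕ∞) ≤ (fixedSet A.dom).encard :=
      calc (k : ℕ∞) = (Set.range fun i : Fin k => A.val i).encard := by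
            simp [← Set.image_univ, hinj.encard_image]
        _ ≤ _ := Set.encard_le_encard (Set.range_subset_iff.2 fun i => (hv i i.2).1)
    rw [hc] at hle
    exact_mod_cast hle
  · intro hk
    -- The moved points are all sent to 0, so 0 itself has to be fixed; f(1) = 1 guarantees at least
    -- one fixed point.
    have ha : 0 < countValues f true n := by
      have := countValues_mono f true (one_le (a := n))
      rw [countValues_one, if_pos hf] at this
      exact this
    have han : countValues f true n ≤ n := by
      have := countValues_add f n
      omega
    obtain ⟨a, haa⟩ : ∃ a, countValues f true n = a := ⟨_, rfl⟩
    rw [haa] at hk ha han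
    let := sigmaSFinStructure n a
    let := sigmaPStructure (Fin n) n
    let val : ℕ → Fin n := fun i => if hi : i < a then ⟨i, hi.trans_le han⟩ else ⟨0, n.pos⟩
    refine ⟨⟨Fin n, sigmaS.sumStructure sigmaP (Fin n), val⟩, ?_, ?_⟩
    · refine model_combine_iff.2 ⟨model_Tf_iff.2 fun j => ?_, model_Teq_iff.2 fun j hj => ?_⟩
      · have h1 : (fixedSet (Fin n)).ncard = a := by
          have : fixedSet (Fin n) = Set.range (Fin.castLE han) := by
            ext x
            rw [mem_fixedSet_sigmaSFinStructure ha, Fin.range_castLE, Set.mem_ofPred_eq]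
          rw [this, ← Set.image_univ, Set.ncard_image_of_injective _ (Fin.castLE_injective han),
            Set.ncard_univ, Nat.card_fin]
        have h2 : (fixedSet (Fin n))ᶜ.ncard = countValues f false n := by
          have h3 := Set.ncard_add_ncard_compl (fixedSet (Fin n))
          have h4 := countValues_add f n
          rw [Nat.card_fin] at h3
          omega
        rw [← (Set.toFinite (fixedSet (Fin n))).cast_ncard_eq,
          ← (Set.toFinite (fixedSet (Fin n))ᶜ).cast_ncard_eq, h1, h2, ← haa]
        norm_cast
        -- Up to index n the lower bounds hold by monotonicity; from n on, the exact pair with index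
        -- n is among the disjuncts.
        rcases le_total j n with hj | hj
        · exact .inl ⟨countValues_mono f true hj, countValues_mono f false hj⟩
        · exact .inr ⟨n, hj, rfl, rfl⟩
      · have hj : (j : ℕ) = n := hj
        rw [hj, Cardinal.mk_fin]
    · refine (realize_sizeAndFixedPoints n k).2 ⟨rfl, fun i hi => ⟨?_, fun j hj => ?_⟩⟩
      · refine (mem_fixedSet_sigmaSFinStructure ha _).2 ?_
        simp [val, hi.trans_le hk]
      · have h1 : i < a := hi.trans_le hk
        have h2 : j < a := hj.trans h1
        simp only [val, h1, h2, dite_true, ne_eq, Fin.mk.injEq]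
        omega

/-! ### Computing the codes of the test formulas -/

/-- The code of an implication. -/
def impCode (x y : ℕ) : ℕ := 4 * Nat.pair x y + 3

/-- The code of an equation. -/
def equalCode (t u : ℕ) : ℕ := 4 * Nat.pair t u + 1

theorem primrec_impCode : Primrec₂ impCode :=
  Primrec.nat_add.comp (Primrec.nat_mul.comp (Primrec.const 4) Primrec₂.natPair) (Primrec.const 3)

theorem primrec_equalCode : Primrec₂ equalCode :=
  Primrec.nat_add.comp (Primrec.nat_mul.comp (Primrec.const 4) Primrec₂.natPair) (Primrec.const 1)

/-- The code of `distinctImp`. -/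
def distinctImpCode (i c j : ℕ) : ℕ :=
  j.rec c fun j r => impCode (impCode (equalCode (4 * j) (4 * i)) 0) r

/-- The code of `notFixedPoints`. -/
def notFixedPointsCode (k : ℕ) : ℕ :=
  k.rec 0 fun k r => impCode (equalCode (sCode (4 * k)) (4 * k)) (distinctImpCode k r k)

/-- The code of `sizeAndFixedPoints`. -/
def sizeAndFixedPointsCode (n k : ℕ) : ℕ :=
  -- `2 * n + 1` is the encoding, in the right summand of the signature, of the predicate symbol
  -- with encoding `n`.
  impCode (impCode (4 * Nat.pair (Nat.pair 0 (2 * n + 1)) 0 + 2) (notFixedPointsCode k)) 0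

theorem formulaCode_varEq (i j : ℕ) : formulaCode (varEq i j) = equalCode (4 * i) (4 * j) := by
  rw [varEq, formulaCode, termCode_var, termCode_var, equalCode]

/-- The symbol `s` has encoding 0, and doubling it for the left summand leaves 0, so `sCode` also
works in the joint signature. -/
theorem formulaCode_varFixed (i : ℕ) :
    formulaCode (varFixed i) = equalCode (sCode (4 * i)) (4 * i) := by
  have h : (List.ofFn fun k : Fin 1 =>
      termCode ((![.var (Sum.inl i)] : Fin 1 → sigmaSP.Term (ℕ ⊕ Fin 0)) k)) = [4 * i] := by
    simp [termCode_var]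
  rw [varFixed, formulaCode, termCode_var, termCode, h]
  rfl

theorem formulaCode_distinctImp (i : ℕ) (φ : sigmaSP.Formula ℕ) (j : ℕ) :
    formulaCode (distinctImp i φ j) = distinctImpCode i (formulaCode φ) j := by
  induction j with
  | zero => rfl
  | succ j ih =>
    have h : formulaCode (distinctImp i φ (j + 1)) =
      impCode (impCode (formulaCode (varEq j i)) 0) (formulaCode (distinctImp i φ j)) := rfl
    rw [h, ih, formulaCode_varEq]
    rfl

theorem formulaCode_notFixedPoints (k : ℕ) :
    formulaCode (notFixedPoints k) = notFixedPointsCode k := by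
  induction k with
  | zero => rfl
  | succ k ih =>
    have h : formulaCode (notFixedPoints (k + 1)) =
      impCode (formulaCode (varFixed k)) (formulaCode (distinctImp k (notFixedPoints k) k)) := rfl
    rw [h, formulaCode_varFixed, formulaCode_distinctImp, ih]
    rfl

theorem formulaCode_sizeAndFixedPoints (n k : ℕ) :
    formulaCode (sizeAndFixedPoints n.succPNat k) = sizeAndFixedPointsCode n k := by
  have h : formulaCode (sizeAndFixedPoints n.succPNat k) =
      impCode (impCode (4 * Nat.pair (Nat.pair 0
        (2 * n.succPNat.natPred + 1)) 0 + 2) (formulaCode (notFixedPoints k))) 0 := by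
    rw [sizeAndFixedPoints, formulaCode, formulaCode, formulaCode, formulaCode, List.ofFn_zero]
    rfl
  rw [h, Nat.natPred_succPNat, formulaCode_notFixedPoints]
  rfl

theorem primrec_sizeAndFixedPointsCode : Primrec₂ sizeAndFixedPointsCode := by
  have four {α : Type} [Primcodable α] {g : α → ℕ} (hg : Primrec g) : Primrec fun a => 4 * g a :=
    Primrec.nat_mul.comp (Primrec.const 4) hg
  have h1 : Primrec fun p : (ℕ × ℕ) × ℕ => distinctImpCode p.1.1 p.1.2 p.2 :=
    Primrec.nat_rec' (h := fun (p : (ℕ × ℕ) × ℕ) (q : ℕ × ℕ) =>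
        impCode (impCode (equalCode (4 * q.1) (4 * p.1.1)) 0) q.2)
      Primrec.snd (Primrec.snd.comp Primrec.fst)
      (primrec_impCode.comp
        (primrec_impCode.comp
          (primrec_equalCode.comp (four (Primrec.fst.comp Primrec.snd))
            (four (Primrec.fst.comp (Primrec.fst.comp Primrec.fst))))
          (Primrec.const 0))
        (Primrec.snd.comp Primrec.snd))
  have h2 : Primrec notFixedPointsCode :=
    Primrec.nat_rec₁ 0 (f := fun k r =>
        impCode (equalCode (sCode (4 * k)) (4 * k)) (distinctImpCode k r k))
      (primrec_impCode.comp
        (primrec_equalCode.comp (primrec_sCode.comp (four Primrec.fst)) (four Primrec.fst))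
        (h1.comp ((Primrec.fst.pair Primrec.snd).pair Primrec.fst)))
  refine primrec_impCode.comp (primrec_impCode.comp ?_ (h2.comp Primrec.snd)) (Primrec.const 0)
  refine Primrec.nat_add.comp (four (Primrec₂.natPair.comp (Primrec₂.natPair.comp (Primrec.const 0)
    ?_) (Primrec.const 0))) (Primrec.const 2)
  exact Primrec.succ.comp (Primrec.nat_mul.comp (Primrec.const 2) Primrec.fst)

/-- Since f₁ grows by at most 1 at each step, asking whether f₁(n) + 1 ≤ f₁(n + 1) reveals f(n + 1).
With f₁(1) = 1 as start, f₁ is computed by recursion from these answers alone, and then `f` is read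
off. -/
theorem computable_of_isDecidable_combine {f : ℕ+ → Bool} (hf : f 1 = true)
    (h : IsDecidable (combine (Tf f) Teq)) : Computable f := by
  obtain ⟨d, hd, hdec⟩ := ComputablePred.computable_iff.1 h
  have hd' (n k : ℕ) :
      d (sizeAndFixedPointsCode n k) = true ↔ k ≤ countValues f true n.succPNat := by
    rw [← satisfiable_sizeAndFixedPoints_iff hf, ← iff_of_eq (congrFun hdec _),
      ← formulaCode_sizeAndFixedPoints]
    constructor
    · rintro ⟨φ, -, hφ, hc⟩
      rwa [← formulaCode_injective hc]
    · exact fun hs => ⟨_, isQF_sizeAndFixedPoints _ _, hs, rfl⟩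
  have hstep (n : ℕ) : d (sizeAndFixedPointsCode (n + 1) (countValues f true n.succPNat + 1)) =
      f (n + 1).succPNat := by
    rw [Bool.eq_iff_iff, hd', countValues_succ]
    split_ifs with h <;> simp [h]
  have hcd : Computable₂ fun n k => d (sizeAndFixedPointsCode n k) :=
    hd.comp primrec_sizeAndFixedPointsCode.to_comp
  have hcount : Computable fun n : ℕ => countValues f true n.succPNat := by
    refine (Computable.nat_rec (α := ℕ) (f := fun n => n) (g := fun _ => 1)
      (h := fun _ q => bif d (sizeAndFixedPointsCode (q.1 + 1) (q.2 + 1)) then q.2 + 1 else q.2)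
      Computable.id (Computable.const 1) ?_).of_eq fun n => ?_
    · have h1 : Computable fun p : ℕ × ℕ × ℕ => p.2.1 + 1 :=
        Computable.succ.comp (Computable.fst.comp Computable.snd)
      have h2 : Computable fun p : ℕ × ℕ × ℕ => p.2.2 := Computable.snd.comp Computable.snd
      exact Computable.cond (hcd.comp h1 (Computable.succ.comp h2)) (Computable.succ.comp h2) h2
    · induction n with
      | zero => exact ((countValues_one f true).trans (if_pos hf)).symm
      | succ n ih =>
        dsimp only at ih ⊢
        rw [ih, hstep, countValues_succ]
        cases f (n + 1).succPNat <;> rfl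
  have hsucc : Computable fun n : ℕ => f n.succPNat := by
    refine (Computable.nat_casesOn (α := ℕ) (f := fun n => n) (g := fun _ => true)
      (h := fun _ n => d (sizeAndFixedPointsCode (n + 1) (countValues f true n.succPNat + 1)))
      Computable.id (Computable.const true) ?_).of_eq fun n => ?_
    · exact hcd.comp (Computable.succ.comp Computable.snd)
        (Computable.succ.comp (hcount.comp Computable.snd))
    · cases n with
      | zero => exact hf.symm
      | succ n => exact hstep n
  -- On positive integers `encode` is the predecessor, which undoes `succPNat`.
  refine (hsucc.comp (Computable.encode (α := ℕ+))).of_eq fun n => ?_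
  exact congrArg f (PNat.succPNat_natPred n)

end TheoryCombination

theorem mainTheorem7 :
    (∃ f : ℕ+ → Bool, TheoryCombination.IsAdmissible f) ∧
    ∀ f : ℕ+ → Bool, TheoryCombination.IsAdmissible f →
      TheoryCombination.IsDecidable (TheoryCombination.Tf f) ∧
      TheoryCombination.IsDecidable TheoryCombination.Teq ∧
      TheoryCombination.HasFiniteModelProperty TheoryCombination.Teq ∧
      TheoryCombination.HasComputableMinimalModelFunction TheoryCombination.Teq ∧
      ¬ TheoryCombination.IsSmooth TheoryCombination.Teq ∧
      ¬ TheoryCombination.IsDecidable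
          (TheoryCombination.combine (TheoryCombination.Tf f) TheoryCombination.Teq) :=
  ⟨TheoryCombination.exists_isAdmissible, fun f hf =>
    ⟨TheoryCombination.isDecidable_Tf f, TheoryCombination.isDecidable_Teq,
      TheoryCombination.hasFiniteModelProperty_Teq,
      TheoryCombination.hasComputableMinimalModelFunction_Teq,
      TheoryCombination.not_isSmooth_Teq,
      fun h => hf.1 (TheoryCombination.computable_of_isDecidable_combine hf.2.1 h)⟩⟩
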